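/- Conventions. An $N$-mode continuous-variable system has state space $L^2(\mathbb R^N)$ with canonical operators $(\hat R_1,\dots,\hat R_{2N})=(\hat Q_1,\hat P_1,\dots,\hat Q_N,\hat P_N)$, $(\hat Q_j\varphi)(t)=t_j\varphi(t)$, $\hat P_j=-i\,\partial/\partial t_j$, and Weyl operators $W(z)=\exp(i\sum_k z_k\hat R_k)$, $z\in\mathbb R^{2N}$. A state $\rho$ with finite second moments has displacement vector $d_k=\mathrm{tr}(\rho\hat R_k)$ and covariance matrix $\Gamma_{kl}=\mathrm{tr}[\rho(\Delta\hat R_k\Delta\hat R_l+\Delta\hat R_l\Delta\hat R_k)]$, where $\Delta\hat R_k=\hat R_k-d_k$; it is Gaussian if $\mathrm{tr}(\rho W(z))=\exp(-\tfrac14 z^T\Gamma z+i\,d^Tz)$ for all $z\in\mathbb R^{2N}$, and pure if $\rho=|\psi\rangle\langle\psi|$ for a unit vector $\psi$. For an $(n+m)$-mode bipartite state $\rho_{AB}$ with covariance matrix $\Gamma=\begin{pmatrix}A&C\\C^T&B\end{pmatrix}$, where $A\in M_{2n}(\mathbb R)$ and $B\in M_{2m}(\mathbb R)$, put $$\mathcal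 M(\rho_{AB})=1-\frac{\det\Gamma}{\det A\,\det B}.$$ A real $2N\times2N$ matrix $S$ is symplectic if $S\Delta S^T=\Delta$, where $\Delta=\bigoplus_{j=1}^N\begin{pmatrix}0&1\\-1&0\end{pmatrix}$. For $n\le m$, real numbers $\gamma_1,\dots,\gamma_n\ge1$ are called single-mode mixedness factors of a mode-wise decomposition of $\rho_{AB}$ if there are symplectic matrices $S_A$ (of size $2n$) and $S_B$ (of size $2m$) with $$(S_A\oplus S_B)\,\Gamma\,(S_A\oplus S_B)^T=\bigoplus_{j=1}^n\begin{pmatrix}\gamma_j&0&\sqrt{\gamma_j^2-1}&0\\0&\gamma_j&0&-\sqrt{\gamma_j^2-1}\\\sqrt{\gamma_j^2-1}&0&\gamma_j&0\\0&-\sqrt{\gamma_j^2-1}&0&\gamma_j\end{pmatrix}\oplus I_{2(m-n)},$$ where the $j$-th $4\times4$ block refers to the $j$-th mode of $A$ together with the $j$-th mode of $B$, and $I_{2(m-n)}$ to the last $m-n$ modes of $B$. Theorem. Let $1\le n\le m$ and let $\rho_{AB}$ be an $(n+m)$-mode pure Gaussian state. Then $\rho_{AB}$ has a mode-wise decomposition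 as above, and for the single-mode mixedness factors $\gamma_1,\dots,\gamma_n$ of any such decomposition $$\mathcal M(\rho_{AB})=1-\frac1{\prod_{j=1}^n\gamma_j^4}.$$ In particular, every $(1+m)$-mode pure Gaussian state with $m\ge1$ has such a decomposition, with a single mixedness factor $\gamma\ge1$, and $\mathcal M(\rho_{AB})=1-1/\gamma^4$ for the mixedness factor $\gamma$ of any such decomposition. -/

import Mathlib

open MeasureTheory
open scoped ContDiff Kronecker InnerProductSpace

noncomputable section

namespace CV

/-! ## Continuous-variable systems (Schrödinger representation) -/

/-- Configuration space `ℝ^ι`, where `ι` is the finite set of modes. -/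
abbrev Config (ι : Type) [Fintype ι] : Type := EuclideanSpace ℝ ι

/-- The state space of the CV system with set of modes `ι`: the Hilbert space `L²(ℝ^ι; ℂ)`,
that is, the tensor product over the modes of the single-mode spaces `L²(ℝ; ℂ)`. -/
abbrev Space (ι : Type) [Fintype ι] : Type := Lp ℂ 2 (volume : Measure (Config ι))

/-- Indices of the canonical operators `(Q₁, P₁, …, Q_N, P_N)`:
`(j, 0)` stands for `Q_j` and `(j, 1)` for `P_j`. -/
abbrev Phase (ι : Type) : Type := ι × Fin 2

section Operators

variable {ι : Type} [Fintype ι] [DecidableEq ι]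

/-- `φ` is in the domain of the position operator `Q_j` and `Q_j φ = η`, where
`(Q_j φ)(t) = t_j φ(t)` on the maximal domain. -/
def IsPosition (j : ι) (φ η : Space ι) : Prop :=
  ∀ᵐ t : Config ι, η t = (t j : ℂ) * φ t

/-- `φ` is in the domain of the momentum operator `P_j` and `P_j φ = η`, where
`P_j = -i ∂/∂t_j` in the sense of weak derivatives, on the maximal domain. -/
def IsMomentum (j : ι) (φ η : Space ι) : Prop :=
  ∀ f : Config ι → ℝ, ContDiff ℝ ∞ f → HasCompactSupport f →
    ∫ t, f t • η t = Complex.I * ∫ t, (fderiv ℝ f t (EuclideanSpace.single j 1)) • φ t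

/-- The graph of the canonical operator `R_k`. -/
def IsQuadrature (k : Phase ι) (φ η : Space ι) : Prop :=
  if k.2 = 0 then IsPosition k.1 φ η else IsMomentum k.1 φ η

theorem IsQuadrature.unique {k : Phase ι} {φ η η' : Space ι}
    (h : IsQuadrature k φ η) (h' : IsQuadrature k φ η') : η = η' := by
  unfold IsQuadrature at h h'
  split_ifs at h h' with hk
  · refine Lp.ext ?_
    filter_upwards [h, h'] with t ht ht'
    rw [ht, ht']
  · have hl : ∀ ζ : Space ι, LocallyIntegrable ζ (volume : Measure (Config ι)) := fun ζ =>
      (Lp.memLp ζ).locallyIntegrable (by norm_num)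
    have key := ae_eq_zero_of_integral_contDiff_smul_eq_zero ((hl η).sub (hl η')) ?_
    · refine Lp.ext ?_
      filter_upwards [key] with t ht
      exact sub_eq_zero.mp ht
    · intro f hf hc
      have e := (h f hf hc).trans (h' f hf hc).symm
      have i1 := (hl η).integrable_smul_left_of_hasCompactSupport hf.continuous hc
      have i2 := (hl η').integrable_smul_left_of_hasCompactSupport hf.continuous hc
      simp only [Pi.sub_apply, smul_sub]
      rw [integral_sub i1 i2, e, sub_self]

/-- The domain of the canonical operator `R_k`. -/
def InDomain (k : Phase ι) (φ : Space ι) : Prop := ∃ η, IsQuadrature k φ η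

open Classical in
/-- The value `R_k φ` of the canonical operator `R_k` (with value `0` off its domain). -/
def quadrature (k : Phase ι) (φ : Space ι) : Space ι :=
  if h : InDomain k φ then h.choose else 0

end Operators

section Weyl

variable {ι : Type} [Fintype ι]

/-- The translation vector `y` of the phase space point `z = (x₁, y₁, …, x_N, y_N)`. -/
def shift (z : Phase ι → ℝ) : Config ι := WithLp.toLp 2 fun j => z (j, 1)

/-- The function `t ↦ exp(i x·t + i x·y/2)` for `z = (x₁, y₁, …, x_N, y_N)`. -/
def weylPhase (z : Phase ι → ℝ) (t : Config ι) : ℂ :=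
  Complex.exp (((∑ j, z (j, 0) * t j + (∑ j, z (j, 0) * z (j, 1)) / 2 : ℝ) : ℂ) * Complex.I)

theorem norm_weylPhase (z : Phase ι → ℝ) (t : Config ι) : ‖weylPhase z t‖ = 1 :=
  Complex.norm_exp_ofReal_mul_I _

theorem continuous_weylPhase (z : Phase ι → ℝ) : Continuous (weylPhase z) := by
  unfold weylPhase
  fun_prop

theorem memLp_weyl (z : Phase ι → ℝ) (φ : Space ι) :
    MemLp (fun t => weylPhase z t * φ (t + shift z)) 2 (volume : Measure (Config ι)) := by
  have h := (Lp.memLp φ).comp_measurePreserving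
    (measurePreserving_add_right (volume : Measure (Config ι)) (shift z))
  refine h.congr_norm ((continuous_weylPhase z).aestronglyMeasurable.mul h.1) ?_
  filter_upwards with t
  simp [norm_weylPhase]

/-- The Weyl displacement operator `W(z) = exp(i Rᵀ z) = exp(i ∑ (x_j Q_j + y_j P_j))`, which is
`(W(z) φ)(t) = exp(i x·t + i x·y/2) φ(t + y)`. -/
def weyl (z : Phase ι → ℝ) : Space ι →ₗᵢ[ℂ] Space ι where
  toFun φ := (memLp_weyl z φ).toLp _
  map_add' φ ψ := by
    rw [← MemLp.toLp_add]
    refine MemLp.toLp_congr _ _ ?_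
    have h := (measurePreserving_add_right (volume : Measure (Config ι))
      (shift z)).quasiMeasurePreserving.ae (Lp.coeFn_add φ ψ)
    filter_upwards [h] with t ht
    simp only [Pi.add_apply] at ht ⊢
    rw [ht, mul_add]
  map_smul' c φ := by
    rw [RingHom.id_apply, ← MemLp.toLp_const_smul]
    refine MemLp.toLp_congr _ _ ?_
    have h := (measurePreserving_add_right (volume : Measure (Config ι))
      (shift z)).quasiMeasurePreserving.ae (Lp.coeFn_smul c φ)
    filter_upwards [h] with t ht
    simp only [Pi.smul_apply, smul_eq_mul] at ht ⊢
    rw [ht]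
    ring
  norm_map' φ := by
    change ‖(memLp_weyl z φ).toLp _‖ = ‖φ‖
    rw [Lp.norm_toLp, Lp.norm_def,
      ← eLpNorm_comp_measurePreserving (Lp.memLp φ).1
        (measurePreserving_add_right (volume : Measure (Config ι)) (shift z))]
    congr 1
    refine eLpNorm_congr_norm_ae ?_
    filter_upwards with t
    simp [norm_weylPhase]

end Weyl

/-! ## States, moments, Gaussian states -/

section Trace

variable {H : Type} [NormedAddCommGroup H] [InnerProductSpace ℂ H] [CompleteSpace H]

/-- Index set of a fixed orthonormal basis. -/
def basisIndex (H : Type) [NormedAddCommGroup H] [InnerProductSpace ℂ H] [CompleteSpace H] :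
    Set H := (exists_hilbertBasis ℂ H).choose

/-- A fixed orthonormal basis. -/
def basis (H : Type) [NormedAddCommGroup H] [InnerProductSpace ℂ H] [CompleteSpace H] :
    HilbertBasis (basisIndex H) ℂ H := (exists_hilbertBasis ℂ H).choose_spec.choose

/-- The trace `tr T = ∑ᵢ ⟨eᵢ, T eᵢ⟩` (for `T` of trace class it does not depend on the basis). -/
def trace (T : H →L[ℂ] H) : ℂ := ∑' i, ⟪basis H i, T (basis H i)⟫_ℂ

/-- The positive square root of a positive operator. -/
def opSqrt (T : H →L[ℂ] H) : H →L[ℂ] H := CFC.sqrt T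

end Trace

/-- A quantum state: a positive operator of trace one. (A positive operator for which the series
does not converge has `trace = 0` by convention, so it is not a state.) -/
structure State (ι : Type) [Fintype ι] where
  /-- The density operator. -/
  op : Space ι →L[ℂ] Space ι
  isPositive : op.IsPositive
  trace_eq_one : trace op = 1

namespace State

variable {ι : Type} [Fintype ι]

/-- A pure state: `ρ = |ψ⟩⟨ψ|` for a unit vector `ψ`. -/
def IsPure (ρ : State ι) : Prop :=
  ∃ ψ : Space ι, ‖ψ‖ = 1 ∧ ∀ φ, ρ.op φ = ⟪ψ, φ⟫_ℂ • ψ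

/-- The characteristic function `χ_ρ(z) = tr(ρ W(z))`. -/
def charFn (ρ : State ι) (z : Phase ι → ℝ) : ℂ :=
  trace (ρ.op ∘L (weyl z).toContinuousLinearMap)

/-- The vectors `√ρ eᵢ`. -/
def sqrtVec (ρ : State ι) (i : basisIndex (Space ι)) : Space ι :=
  opSqrt ρ.op (basis (Space ι) i)

/-- The expectation `tr(ρ X Y) = tr((X√ρ)† (Y√ρ)) = ∑ᵢ ⟨X √ρ eᵢ, Y √ρ eᵢ⟩` for symmetric, possibly
unbounded, operators `X`, `Y` for which `X√ρ` and `Y√ρ` are Hilbert–Schmidt. -/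
def expect (ρ : State ι) (X Y : Space ι → Space ι) : ℂ :=
  ∑' i, ⟪X (ρ.sqrtVec i), Y (ρ.sqrtVec i)⟫_ℂ

variable [DecidableEq ι]

/-- Finite second moments: `tr(ρ R_k²) = ∑ᵢ ‖R_k √ρ eᵢ‖² < ∞` for every canonical operator. -/
def HasFiniteSecondMoments (ρ : State ι) : Prop :=
  ∀ k : Phase ι, (∀ i, InDomain k (ρ.sqrtVec i)) ∧
    Summable fun i => ‖quadrature k (ρ.sqrtVec i)‖ ^ 2

/-- The displacement vector `d_k = tr(ρ R_k)` (a real number). -/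
def mean (ρ : State ι) (k : Phase ι) : ℝ := (ρ.expect id (quadrature k)).re

/-- The centred operator `ΔR_k = R_k - d_k`. -/
def centred (ρ : State ι) (k : Phase ι) (φ : Space ι) : Space ι :=
  quadrature k φ - (ρ.mean k : ℂ) • φ

/-- The covariance matrix `γ_{kl} = tr[ρ (ΔR_k ΔR_l + ΔR_l ΔR_k)]` (a real number). -/
def cov (ρ : State ι) : Matrix (Phase ι) (Phase ι) ℝ := Matrix.of fun k l =>
  (ρ.expect (ρ.centred k) (ρ.centred l) + ρ.expect (ρ.centred l) (ρ.centred k)).re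

/-- Gaussian states: finite second moments and `χ_ρ(z) = exp(-¼ zᵀ Γ_ρ z + i d_ρᵀ z)`. -/
def IsGaussian (ρ : State ι) : Prop :=
  ρ.HasFiniteSecondMoments ∧ ∀ z : Phase ι → ℝ,
    ρ.charFn z = Complex.exp
      (-(1 / 4 : ℂ) * ((z ⬝ᵥ ρ.cov.mulVec z : ℝ) : ℂ) + Complex.I * ((ρ.mean ⬝ᵥ z : ℝ) : ℂ))

end State

/-! ## Bipartite systems -/

section Bipartite

variable {n m : ℕ}

/-- The state of an `(n+m)`-mode system: the modes of `A` are `Fin n`, those of `B` are `Fin m`. -/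
abbrev BiState (n m : ℕ) : Type := State (Fin n ⊕ Fin m)

/-- The covariance matrix of an `(n+m)`-mode state in block form
`Γ = [[A, C], [Cᵀ, B]]` with respect to the canonical operators of `A` and of `B`. -/
def blockCov (ρ : BiState n m) :
    Matrix (Phase (Fin n) ⊕ Phase (Fin m)) (Phase (Fin n) ⊕ Phase (Fin m)) ℝ :=
  ρ.cov.submatrix (Equiv.sumProdDistrib (Fin n) (Fin m) (Fin 2)).symm
    (Equiv.sumProdDistrib (Fin n) (Fin m) (Fin 2)).symm

/-- `M(ρ_AB) = 1 - det Γ / (det A · det B)`. -/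
def corr (ρ : BiState n m) : ℝ :=
  1 - (blockCov ρ).det / ((blockCov ρ).toBlocks₁₁.det * (blockCov ρ).toBlocks₂₂.det)

/-- The form `Δ = ⊕ⱼ [[0, 1], [-1, 0]]`. -/
def sympForm (ι : Type) [DecidableEq ι] : Matrix (Phase ι) (Phase ι) ℝ :=
  (1 : Matrix ι ι ℝ) ⊗ₖ !![0, 1; -1, 0]

/-- `S ∈ Sp(2N, ℝ)`, that is, `S Δ Sᵀ = Δ`. -/
def IsSymplectic {ι : Type} [Fintype ι] [DecidableEq ι] (S : Matrix (Phase ι) (Phase ι) ℝ) : Prop :=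
  S * sympForm ι * S.transpose = sympForm ι

/-- The `A`–`B` block of the mode-wise normal form: the `j`-th mode of `A` is coupled to the `j`-th
mode of `B` by `diag(√(γ_j² - 1), -√(γ_j² - 1))`. -/
def normalFormC (n m : ℕ) (γ : Fin n → ℝ) : Matrix (Phase (Fin n)) (Phase (Fin m)) ℝ :=
  Matrix.of fun p q =>
    if (p.1 : ℕ) = (q.1 : ℕ) ∧ p.2 = q.2 then
      (if p.2 = 0 then Real.sqrt (γ p.1 ^ 2 - 1) else -Real.sqrt (γ p.1 ^ 2 - 1))
    else 0

/-- The mode-wise normal form: the direct sum, over `j < n`, of the two-mode matrices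
`[[γ_j I, diag(s_j, -s_j)], [diag(s_j, -s_j), γ_j I]]` with `s_j = √(γ_j² - 1)` on the `j`-th mode of
`A` and the `j`-th mode of `B`, and of the identity on the last `m - n` modes of `B`. -/
def normalForm (n m : ℕ) (γ : Fin n → ℝ) :
    Matrix (Phase (Fin n) ⊕ Phase (Fin m)) (Phase (Fin n) ⊕ Phase (Fin m)) ℝ :=
  Matrix.fromBlocks
    (Matrix.diagonal fun p => γ p.1)
    (normalFormC n m γ)
    (normalFormC n m γ).transpose
    (Matrix.diagonal fun q => if h : (q.1 : ℕ) < n then γ ⟨q.1, h⟩ else 1)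

/-- `γ₁, …, γ_n ≥ 1` are the single-mode mixedness factors of a mode-wise decomposition of `ρ`:
some local symplectic matrix `S = S_A ⊕ S_B` brings the covariance matrix of `ρ` to the mode-wise
normal form with parameters `γ`. -/
def IsMixednessFactors (ρ : BiState n m) (γ : Fin n → ℝ) : Prop :=
  (∀ j, 1 ≤ γ j) ∧
    ∃ (SA : Matrix (Phase (Fin n)) (Phase (Fin n)) ℝ)
      (SB : Matrix (Phase (Fin m)) (Phase (Fin m)) ℝ),
      IsSymplectic SA ∧ IsSymplectic SB ∧
        Matrix.fromBlocks SA 0 0 SB * blockCov ρ * (Matrix.fromBlocks SA 0 0 SB).transpose =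
          normalForm n m γ

end Bipartite

end CV

end

/-! Everything rests on one fact about the covariance matrix Γ of a pure Gaussian state: it is
positive definite and ΓΔΓ = Δ. Granting it, det Γ = 1, and only linear algebra remains.

Analytic part. For ρ = |ψ⟩⟨ψ| the characteristic function is ⟨ψ, W(z)ψ⟩. With the momentum part y of
z fixed, it is, up to a phase, the Fourier transform in the position part of the autocorrelation
conj ψ(t)·ψ(t+y). Fourier uniqueness makes this autocorrelation an explicit Gaussian
(`ae_overlap_eq`). Since it comes from a single function ψ, it satisfies a multiplicative identity
in (t, y), and comparing exponents yields the block relations equivalent to ΓΔΓ = Δ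
(`relations_of_charFn`, `posDef_and_symplectic_of_charFn`).

Algebraic part. Williamson's theorem makes the A block diagonal with entries γ_j. The relation ΓΔΓ =
Δ then says that the rows of C with γ_j > 1, suitably rescaled, form part of a symplectic basis
diagonalizing B. A Williamson theorem with prescribed rows (`exists_symplectic_diagonalization`)
completes that basis, and the relation also fixes the diagonal of B
(`IsPureBlocks.exists_normalForm`).

The formula follows because symplectic matrices have determinant of square one: det A = det B = ∏
γ_j² and det Γ = 1. -/

/-! ### Real normal form of a skew operator. -/

/-- A family of vectors, indexed by `ι × Fin 2`, whose members over `P` are orthonormal and span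
two-dimensional invariant planes on which `K` acts as `μ j` times a rotation by a right angle. -/
structure IsSkewFamily {ι E : Type*} [DecidableEq ι] [NormedAddCommGroup E] [InnerProductSpace ℝ E]
    (K : E →ₗ[ℝ] E) (P : Finset ι) (v : ι × Fin 2 → E) (μ : ι → ℝ) : Prop where
  inner_eq : ∀ p q, p.1 ∈ P → q.1 ∈ P → ⟪v p, v q⟫_ℝ = if p = q then 1 else 0
  pos : ∀ j ∈ P, 0 < μ j
  map_zero : ∀ j ∈ P, K (v (j, 0)) = -(μ j • v (j, 1))
  map_one : ∀ j ∈ P, K (v (j, 1)) = μ j • v (j, 0)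

section Skew

variable {ι E : Type*} [Fintype ι] [DecidableEq ι] [NormedAddCommGroup E] [InnerProductSpace ℝ E]
  [FiniteDimensional ℝ E]

/-- A skew injective operator has an invariant plane in a nonzero invariant subspace. -/
theorem exists_rotation_plane {K : E →ₗ[ℝ] E} (hK : ∀ x y, ⟪K x, y⟫_ℝ = -⟪x, K y⟫_ℝ)
    (hinj : Function.Injective K) (W : Submodule ℝ E) (hW : ∀ x ∈ W, K x ∈ W) (hne : W ≠ ⊥) :
    ∃ e ∈ W, ∃ f ∈ W, ∃ μ : ℝ, 0 < μ ∧ ⟪e, e⟫_ℝ = 1 ∧ ⟪f, f⟫_ℝ = 1 ∧ ⟪e, f⟫_ℝ = 0 ∧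
      K e = -(μ • f) ∧ K f = μ • e := by
  -- The square of a skew operator is symmetric, so it has a unit eigenvector `e` in `W`. Its
  -- eigenvalue is -‖K e‖², which makes the plane of `e` and `K e` invariant; `f` is -`K e`
  -- normalized.
  have hsym : (K ∘ₗ K).IsSymmetric := fun x y => by
    simp only [LinearMap.comp_apply, hK, neg_neg]
  have hinv : ∀ x ∈ W, (K ∘ₗ K) x ∈ W := fun x hx => hW _ (hW _ hx)
  have hres := hsym.restrict_invariant hinv
  have : Nontrivial W := Submodule.nontrivial_iff_ne_bot.mpr hne
  have hpos : 0 < Module.finrank ℝ W := Module.finrank_pos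
  let b := hres.eigenvectorBasis rfl
  let e : W := b ⟨0, hpos⟩
  have he : ⟪(e : E), (e : E)⟫_ℝ = 1 := by
    have := b.orthonormal.1 ⟨0, hpos⟩
    rw [← Submodule.coe_inner, real_inner_self_eq_norm_sq, this, one_pow]
  have heig := hres.apply_eigenvectorBasis rfl ⟨0, hpos⟩
  set l : ℝ := hres.eigenvalues rfl ⟨0, hpos⟩
  have heig' : K (K (e : E)) = l • (e : E) := by
    have := congrArg (fun w : W => (w : E)) heig
    simpa only [LinearMap.coe_restrict_apply, LinearMap.comp_apply, Submodule.coe_smul,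
      RCLike.ofReal_real_eq_id, id_eq] using this
  have hKe : K (e : E) ≠ 0 := by
    intro h
    have h0 : (e : E) = 0 := hinj (h.trans (map_zero K).symm)
    rw [h0, inner_zero_left] at he
    exact zero_ne_one he
  have hn : 0 < ‖K (e : E)‖ := norm_pos_iff.mpr hKe
  have hl : l = -‖K (e : E)‖ ^ 2 := by
    have h1 : ⟪K (e : E), K (e : E)⟫_ℝ = -l := by
      rw [hK, heig', inner_smul_right, he, mul_one]
    rw [← real_inner_self_eq_norm_sq, h1, neg_neg]
  set μ := ‖K (e : E)‖
  refine ⟨e, e.2, -(μ⁻¹ • K (e : E)), W.neg_mem (W.smul_mem _ (hW _ e.2)), μ, hn, he, ?_, ?_, ?_, ?_⟩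
  · rw [inner_neg_neg, inner_smul_left, inner_smul_right, real_inner_self_eq_norm_sq]
    simp only [conj_trivial]
    change μ⁻¹ * (μ⁻¹ * μ ^ 2) = 1
    field_simp
  · have h2 : ⟪(e : E), K (e : E)⟫_ℝ = 0 := by
      have h3 := hK (e : E) (e : E)
      rw [real_inner_comm] at h3
      linarith
    rw [inner_neg_right, inner_smul_right, h2, mul_zero, neg_zero]
  · rw [smul_neg, neg_neg, smul_smul, mul_inv_cancel₀ hn.ne', one_smul]
  · rw [map_neg, map_smul, heig', hl, smul_smul, ← neg_smul]
    congr 1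
    field_simp

/-- The span of the planes over `P` is `K`-invariant, hence by skewness so is its orthogonal
complement. The complement is nonzero because the span has dimension at most 2|P| < 2|ι|, so it
contains one more rotation plane. -/
theorem IsSkewFamily.exists_insert {K : E →ₗ[ℝ] E} (hK : ∀ x y, ⟪K x, y⟫_ℝ = -⟪x, K y⟫_ℝ)
    (hinj : Function.Injective K) (hd : Module.finrank ℝ E = 2 * Fintype.card ι)
    {P : Finset ι} {v : ι × Fin 2 → E} {μ : ι → ℝ} (h : IsSkewFamily K P v μ) {j : ι} (hj : j ∉ P) :
    ∃ v' μ', IsSkewFamily K (insert j P) v' μ' ∧ (∀ p, p.1 ∈ P → v' p = v p) ∧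
      ∀ k ∈ P, μ' k = μ k := by
  classical
  let s : Finset E := (P ×ˢ Finset.univ).image v
  let U := Submodule.span ℝ (s : Set E)
  have hvU : ∀ p, p.1 ∈ P → v p ∈ U := fun p hp =>
    Submodule.subset_span (Finset.mem_coe.mpr (Finset.mem_image.mpr ⟨p, by simp [hp], rfl⟩))
  have hUK : ∀ x ∈ U, K x ∈ U := by
    intro x hx
    have : U ≤ U.comap K := by
      refine Submodule.span_le.mpr ?_
      intro y hy
      obtain ⟨⟨k, a⟩, hp, rfl⟩ := Finset.mem_image.mp (Finset.mem_coe.mp hy)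
      have hk : k ∈ P := (Finset.mem_product.mp hp).1
      change K (v (k, a)) ∈ U
      fin_cases a
      · exact (h.map_zero k hk) ▸ U.neg_mem (U.smul_mem _ (hvU (k, 1) hk))
      · exact (h.map_one k hk) ▸ U.smul_mem _ (hvU (k, 0) hk)
    exact this hx
  have hWK : ∀ x ∈ Uᗮ, K x ∈ Uᗮ := by
    intro x hx
    rw [Submodule.mem_orthogonal] at hx ⊢
    intro u hu
    have := hK u x
    rw [hx _ (hUK u hu)] at this
    linarith
  have hne : Uᗮ ≠ ⊥ := by
    intro hb
    have h1 := Submodule.finrank_add_finrank_orthogonal U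
    rw [hb, finrank_bot, hd] at h1
    have h2 : Module.finrank ℝ U ≤ P.card * 2 :=
      (finrank_span_finset_le_card s).trans
        (Finset.card_image_le.trans (by simp [Finset.card_product]))
    have h3 : P.card < Fintype.card ι := Finset.card_lt_univ_of_notMem hj
    omega
  obtain ⟨e, heW, f, hfW, m, hm, hee, hff, hef, hKe, hKf⟩ := exists_rotation_plane hK hinj _ hWK hne
  rw [Submodule.mem_orthogonal] at heW hfW
  let w : Fin 2 → E := ![e, f]
  have hw : ∀ a b, ⟪w a, w b⟫_ℝ = if a = b then 1 else 0 := by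
    intro a b
    fin_cases a <;> fin_cases b <;> simp only [w] <;>
      first | exact hee | exact hff | exact hef | exact (real_inner_comm e f).trans hef
  have hwv : ∀ p, p.1 ∈ P → ∀ a, ⟪v p, w a⟫_ℝ = 0 := by
    intro p hp a
    fin_cases a
    · exact heW _ (hvU p hp)
    · exact hfW _ (hvU p hp)
  have hPj : ∀ k ∈ P, k ≠ j := fun k hk e => hj (e ▸ hk)
  refine ⟨fun p => if p.1 = j then w p.2 else v p, Function.update μ j m, ⟨?_, ?_, ?_, ?_⟩, ?_, ?_⟩
  · rintro ⟨k, a⟩ ⟨l, b⟩ hp hq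
    simp only [Finset.mem_insert] at hp hq
    by_cases hk : k = j <;> by_cases hl : l = j
    · subst hk hl; simp [hw]
    · have := hwv (l, b) (hq.resolve_left hl) a
      rw [real_inner_comm] at this
      subst hk
      simp [hl, this, Ne.symm hl]
    · subst hl
      simp [hk, hwv (k, a) (hp.resolve_left hk) b]
    · simp only [hk, hl, if_false]
      exact h.inner_eq _ _ (hp.resolve_left hk) (hq.resolve_left hl)
  · intro k hk
    by_cases hkj : k = j
    · subst hkj; simpa using hm
    · simpa [hkj] using h.pos k ((Finset.mem_insert.mp hk).resolve_left hkj)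
  · intro k hk
    by_cases hkj : k = j
    · subst hkj; simpa [w] using hKe
    · simpa [hkj] using h.map_zero k ((Finset.mem_insert.mp hk).resolve_left hkj)
  · intro k hk
    by_cases hkj : k = j
    · subst hkj; simpa [w] using hKf
    · simpa [hkj] using h.map_one k ((Finset.mem_insert.mp hk).resolve_left hkj)
  · intro p hp
    simp [hPj _ hp]
  · intro k hk
    simp [hPj _ hk]

/-- The real normal form of a skew injective operator, starting from a given part of it. -/
theorem IsSkewFamily.exists_extension {K : E →ₗ[ℝ] E} (hK : ∀ x y, ⟪K x, y⟫_ℝ = -⟪x, K y⟫_ℝ)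
    (hinj : Function.Injective K) (hd : Module.finrank ℝ E = 2 * Fintype.card ι)
    {P : Finset ι} {v : ι × Fin 2 → E} {μ : ι → ℝ} (h : IsSkewFamily K P v μ) :
    ∃ v' μ', IsSkewFamily K Finset.univ v' μ' ∧ (∀ p, p.1 ∈ P → v' p = v p) ∧
      ∀ k ∈ P, μ' k = μ k := by
  suffices H : ∀ Q : Finset ι, ∃ v' μ', IsSkewFamily K (Q ∪ P) v' μ' ∧
      (∀ p, p.1 ∈ P → v' p = v p) ∧ ∀ k ∈ P, μ' k = μ k by
    have := H Finset.univ
    rwa [Finset.union_eq_left.mpr (Finset.subset_univ P)] at this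
  intro Q
  induction Q using Finset.induction_on with
  | empty => exact ⟨v, μ, by simpa using h, fun _ _ => rfl, fun _ _ => rfl⟩
  | insert j Q hjQ ih =>
    obtain ⟨v', μ', h', hv, hμ⟩ := ih
    rw [Finset.insert_union]
    by_cases hj : j ∈ Q ∪ P
    · rw [Finset.insert_eq_of_mem hj]
      exact ⟨v', μ', h', hv, hμ⟩
    · obtain ⟨v'', μ'', h'', hv', hμ'⟩ := h'.exists_insert hK hinj hd hj
      exact ⟨v'', μ'', h'', fun p hp => (hv' p (Finset.mem_union_right _ hp)).trans (hv p hp),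
        fun k hk => (hμ' k (Finset.mem_union_right _ hk)).trans (hμ k hk)⟩

end Skew

open scoped MatrixOrder in
/-- A positive definite real matrix has a symmetric invertible square root. -/
theorem Matrix.PosDef.exists_symm_sqrt {κ : Type*} [Fintype κ] [DecidableEq κ] {B : Matrix κ κ ℝ}
    (hB : B.PosDef) : ∃ T : Matrix κ κ ℝ, T.transpose = T ∧ T * T = B ∧ IsUnit T.det := by
  have h1 : CFC.sqrt B * CFC.sqrt B = B := CFC.sqrt_mul_sqrt_self B hB.posSemidef.nonneg
  refine ⟨CFC.sqrt B, ?_, h1, ?_⟩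
  · have h2 := (Matrix.nonneg_iff_posSemidef.mp (CFC.sqrt_nonneg B)).isHermitian
    rwa [Matrix.IsHermitian, Matrix.conjTranspose_eq_transpose_of_trivial] at h2
  · have h3 := (Matrix.isUnit_iff_isUnit_det B).mp hB.isUnit
    rw [← h1, Matrix.det_mul] at h3
    exact isUnit_of_mul_isUnit_left h3

/-! ### Algebra of the symplectic form. -/

namespace CV

section Form

variable {κ : Type} [DecidableEq κ]

theorem sympForm_apply (p q : Phase κ) :
    sympForm κ p q = if p.1 = q.1 then !![(0 : ℝ), 1; -1, 0] p.2 q.2 else 0 := by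
  simp [sympForm, Matrix.kroneckerMap_apply, Matrix.one_apply]

theorem sympForm_transpose : (sympForm κ).transpose = -sympForm κ := by
  ext ⟨i, a⟩ ⟨j, b⟩
  rw [Matrix.transpose_apply, Matrix.neg_apply, sympForm_apply, sympForm_apply]
  by_cases h : i = j
  · subst h
    fin_cases a <;> fin_cases b <;> simp
  · simp [h, Ne.symm h]

variable [Fintype κ]

theorem sympForm_mul_self : sympForm κ * sympForm κ = -1 := by
  rw [sympForm, ← Matrix.mul_kronecker_mul, Matrix.one_mul]
  have : (!![0, 1; -1, 0] : Matrix (Fin 2) (Fin 2) ℝ) * !![0, 1; -1, 0] = (-1 : ℝ) • 1 := by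
    ext i j
    fin_cases i <;> fin_cases j <;> simp
  rw [this, Matrix.kronecker_smul, Matrix.one_kronecker_one, neg_one_smul]

theorem isUnit_det_sympForm : IsUnit (sympForm κ).det := by
  have h := congrArg Matrix.det (sympForm_mul_self (κ := κ))
  rw [Matrix.det_mul, Matrix.det_neg, Matrix.det_one, mul_one] at h
  have h2 : IsUnit ((-1 : ℝ) ^ Fintype.card (Phase κ)) := (isUnit_one.neg).pow _
  rw [← h] at h2
  exact isUnit_of_mul_isUnit_left h2

theorem sympForm_mulVec_injective : Function.Injective (sympForm κ).mulVec :=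
  Matrix.mulVec_injective_iff_isUnit.mpr
    ((Matrix.isUnit_iff_isUnit_det _).mpr isUnit_det_sympForm)

/-- The sign of the determinant is never needed, since a congruence S Γ Sᵀ only involves its square.
-/
theorem IsSymplectic.det_sq {S : Matrix (Phase κ) (Phase κ) ℝ} (h : IsSymplectic S) :
    S.det ^ 2 = 1 := by
  have h1 := congrArg Matrix.det h
  rw [Matrix.det_mul, Matrix.det_mul, Matrix.det_transpose] at h1
  have h2 := (isUnit_det_sympForm (κ := κ)).ne_zero
  have h3 : (S.det ^ 2 - 1) * (sympForm κ).det = 0 := by linear_combination h1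
  linarith [(mul_eq_zero.mp h3).resolve_right h2]

theorem sympForm_mulVec_mulVec (x : Phase κ → ℝ) :
    (sympForm κ).mulVec ((sympForm κ).mulVec x) = -x := by
  rw [Matrix.mulVec_mulVec, sympForm_mul_self, Matrix.neg_mulVec, Matrix.one_mulVec]

theorem dotProduct_sympForm_mulVec_swap (x y : Phase κ → ℝ) :
    x ⬝ᵥ (sympForm κ).mulVec y = -(y ⬝ᵥ (sympForm κ).mulVec x) := by
  rw [Matrix.dotProduct_mulVec, ← Matrix.mulVec_transpose, sympForm_transpose, Matrix.neg_mulVec,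
    neg_dotProduct, dotProduct_comm]

end Form

/-! ### Williamson's theorem with prescribed rows. -/

theorem mul_mul_transpose_apply {α β : Type*} [Fintype β] (S : Matrix α β ℝ) (B : Matrix β β ℝ)
    (p q : α) : (S * B * S.transpose) p q = S.row p ⬝ᵥ B.mulVec (S.row q) := by
  rw [Matrix.mul_assoc, Matrix.mul_apply']
  congr 1

/-- Williamson's theorem: a positive definite matrix is diagonalized by a symplectic matrix, and the
rows of that matrix may be prescribed on a set `P` of modes. -/
theorem exists_symplectic_diagonalization {κ : Type} [Fintype κ] [DecidableEq κ]
    {B : Matrix (Phase κ) (Phase κ) ℝ} (hB : B.PosDef) (P : Finset κ)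
    (s : Phase κ → Phase κ → ℝ) (γ : κ → ℝ) (hγ : ∀ j ∈ P, 0 < γ j)
    (hs : ∀ p q : Phase κ, p.1 ∈ P → q.1 ∈ P →
      s p ⬝ᵥ (sympForm κ).mulVec (s q) = sympForm κ p q)
    (h0 : ∀ j ∈ P, B.mulVec (s (j, 0)) = γ j • (sympForm κ).mulVec (s (j, 1)))
    (h1 : ∀ j ∈ P, B.mulVec (s (j, 1)) = -(γ j • (sympForm κ).mulVec (s (j, 0)))) :
    ∃ (S : Matrix (Phase κ) (Phase κ) ℝ) (β : κ → ℝ), IsSymplectic S ∧ (∀ j, 0 < β j) ∧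
      S * B * S.transpose = Matrix.diagonal (fun p => β p.1) ∧ ∀ p : Phase κ, p.1 ∈ P → S.row p = s p := by
  obtain ⟨T, hT, hTB, hTu⟩ := hB.exists_symm_sqrt
  set Δ := sympForm κ with hΔ
  have hTi : T⁻¹.transpose = T⁻¹ := by rw [Matrix.transpose_nonsing_inv, hT]
  have hTT : T * T⁻¹ = 1 := Matrix.mul_nonsing_inv T hTu
  have hTT' : T⁻¹ * T = 1 := Matrix.nonsing_inv_mul T hTu
  have hdotT : ∀ x y, T.mulVec x ⬝ᵥ y = x ⬝ᵥ T.mulVec y := fun x y => by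
    rw [Matrix.dotProduct_mulVec, ← Matrix.mulVec_transpose, hT]
  have hdotTi : ∀ x y, T⁻¹.mulVec x ⬝ᵥ y = x ⬝ᵥ T⁻¹.mulVec y := fun x y => by
    rw [Matrix.dotProduct_mulVec, ← Matrix.mulVec_transpose, hTi]
  -- With T² = B, substituting x = T⁻¹v turns the form of B into the Euclidean one and Δ into this
  -- skew operator. Diagonalizing B symplectically thus amounts to bringing `K` to its real normal
  -- form.
  let K := Matrix.toEuclideanLin (T⁻¹ * Δ * T⁻¹)
  have hKap : ∀ x, K (WithLp.toLp 2 x) = WithLp.toLp 2 (T⁻¹.mulVec (Δ.mulVec (T⁻¹.mulVec x))) := by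
    intro x
    simp only [K, Matrix.toLpLin_toLp, Matrix.toLin'_apply, Matrix.mulVec_mulVec, Matrix.mul_assoc]
  have hin : ∀ x y : Phase κ → ℝ, ⟪WithLp.toLp 2 x, WithLp.toLp 2 y⟫_ℝ = x ⬝ᵥ y := by
    intro x y
    rw [EuclideanSpace.inner_toLp_toLp, star_trivial, dotProduct_comm]
  have hskew : ∀ x y, ⟪K x, y⟫_ℝ = -⟪x, K y⟫_ℝ := by
    intro x y
    obtain ⟨x, rfl⟩ := (WithLp.toLp_surjective 2) x
    obtain ⟨y, rfl⟩ := (WithLp.toLp_surjective 2) y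
    rw [hKap, hKap, hin, hin, hdotTi, dotProduct_comm, dotProduct_sympForm_mulVec_swap, hdotTi]
  have hinj : Function.Injective K := by
    intro x y hxy
    obtain ⟨x, rfl⟩ := (WithLp.toLp_surjective 2) x
    obtain ⟨y, rfl⟩ := (WithLp.toLp_surjective 2) y
    rw [hKap, hKap] at hxy
    have hxy' := WithLp.toLp_injective 2 hxy
    have hTinj : Function.Injective T⁻¹.mulVec := Matrix.mulVec_injective_iff_isUnit.mpr
      ((Matrix.isUnit_iff_isUnit_det _).mpr (Matrix.isUnit_nonsing_inv_det T hTu))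
    rw [hTinj (sympForm_mulVec_injective (hTinj hxy'))]
  have hd : Module.finrank ℝ (EuclideanSpace ℝ (Phase κ)) = 2 * Fintype.card κ := by
    rw [finrank_euclideanSpace, Fintype.card_prod, Fintype.card_fin, mul_comm]
  have hTB' : ∀ x, T.mulVec (T.mulVec x) = B.mulVec x := fun x => by
    rw [Matrix.mulVec_mulVec, hTB]
  have hTTx : ∀ x, T.mulVec (T⁻¹.mulVec x) = x := fun x => by
    rw [Matrix.mulVec_mulVec, hTT, Matrix.one_mulVec]
  have hTTx' : ∀ x, T⁻¹.mulVec (T.mulVec x) = x := fun x => by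
    rw [Matrix.mulVec_mulVec, hTT', Matrix.one_mulVec]
  have hTBi : ∀ x, T⁻¹.mulVec (B.mulVec x) = T.mulVec x := fun x => by
    rw [← hTB', hTTx']
  have hsB : ∀ p q : Phase κ, p.1 ∈ P → q.1 ∈ P →
      s p ⬝ᵥ B.mulVec (s q) = if p = q then γ q.1 else 0 := by
    rintro ⟨i, a⟩ ⟨j, b⟩ hi hj
    fin_cases b
    · change _ ⬝ᵥ B.mulVec (s (j, 0)) = _
      rw [h0 j hj, dotProduct_smul, hs _ (j, 1) hi hj, hΔ, sympForm_apply]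
      by_cases hij : i = j <;> fin_cases a <;> simp [hij]
    · change _ ⬝ᵥ B.mulVec (s (j, 1)) = _
      rw [h1 j hj, dotProduct_neg, dotProduct_smul, hs _ (j, 0) hi hj, hΔ, sympForm_apply]
      by_cases hij : i = j <;> fin_cases a <;> simp [hij]
  -- The prescribed rows have B-norm √γ, so their normalized images under T are orthonormal.
  -- Relations `h0` and `h1` say that `K` rotates them with factor 1/γ.
  have hfam : IsSkewFamily K P (fun p => WithLp.toLp 2 ((√(γ p.1))⁻¹ • T.mulVec (s p)))
      (fun j => (γ j)⁻¹) := by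
    refine ⟨?_, fun j hj => inv_pos.mpr (hγ j hj), ?_, ?_⟩
    · intro p q hp hq
      rw [hin, smul_dotProduct, dotProduct_smul, hdotT, hTB', hsB p q hp hq]
      by_cases hpq : p = q
      · subst hpq
        have h3 := Real.sqrt_pos.mpr (hγ _ hp)
        have h4 := Real.sq_sqrt (hγ _ hp).le
        simp only [if_true, smul_eq_mul]
        field_simp
        exact h4.symm
      · simp [hpq]
    · intro j hj
      have h3 := (hγ _ hj).ne'
      rw [hKap, ← WithLp.toLp_smul, ← WithLp.toLp_neg]
      congr 1
      have h4 : Δ.mulVec (s (j, 0)) = -((γ j)⁻¹ • B.mulVec (s (j, 1))) := by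
        rw [h1 j hj, smul_neg, neg_neg, smul_smul, inv_mul_cancel₀ h3, one_smul]
      rw [Matrix.mulVec_smul, hTTx', Matrix.mulVec_smul, h4, Matrix.mulVec_smul, Matrix.mulVec_neg,
        Matrix.mulVec_smul, hTBi, smul_neg, smul_smul, smul_smul, mul_comm]
    · intro j hj
      have h3 := (hγ _ hj).ne'
      rw [hKap, ← WithLp.toLp_smul]
      congr 1
      have h4 : Δ.mulVec (s (j, 1)) = (γ j)⁻¹ • B.mulVec (s (j, 0)) := by
        rw [h0 j hj, smul_smul, inv_mul_cancel₀ h3, one_smul]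
      rw [Matrix.mulVec_smul, hTTx', Matrix.mulVec_smul, h4, Matrix.mulVec_smul,
        Matrix.mulVec_smul, hTBi, smul_smul, smul_smul, mul_comm]
  obtain ⟨v, μ, hv, hvP, hμP⟩ := hfam.exists_extension hskew hinj hd
  have hμ : ∀ j, 0 < μ j := fun j => hv.pos j (Finset.mem_univ j)
  have hvin : ∀ p q, (v p).ofLp ⬝ᵥ (v q).ofLp = if p = q then 1 else 0 := fun p q => by
    rw [← hin]; exact hv.inner_eq p q (Finset.mem_univ _) (Finset.mem_univ _)
  have hv0 : ∀ j, T⁻¹.mulVec (Δ.mulVec (T⁻¹.mulVec (v (j, 0)).ofLp)) = -(μ j • (v (j, 1)).ofLp) :=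
    fun j => WithLp.toLp_injective 2 ((hKap _).symm.trans (hv.map_zero j (Finset.mem_univ j)))
  have hv1 : ∀ j, T⁻¹.mulVec (Δ.mulVec (T⁻¹.mulVec (v (j, 1)).ofLp)) = μ j • (v (j, 0)).ofLp :=
    fun j => WithLp.toLp_injective 2 ((hKap _).symm.trans (hv.map_one j (Finset.mem_univ j)))
  -- The factor μ^(-1/2) normalizes the Δ-pairing of the two rows of a mode, which is μ for the
  -- vectors T⁻¹v, to 1; the B-norm squared then becomes 1/μ.
  let S : Matrix (Phase κ) (Phase κ) ℝ := Matrix.of fun p => √((μ p.1)⁻¹) • T⁻¹.mulVec (v p).ofLp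
  have hrow : ∀ p, S.row p = √((μ p.1)⁻¹) • T⁻¹.mulVec (v p).ofLp := fun _ => rfl
  refine ⟨S, fun j => (μ j)⁻¹, ?_,
    fun j => inv_pos.mpr (hμ j), ?_, ?_⟩
  · have hsq : ∀ j, √((μ j)⁻¹) * √((μ j)⁻¹) * μ j = 1 := fun j => by
      rw [Real.mul_self_sqrt (inv_pos.mpr (hμ j)).le, inv_mul_cancel₀ (hμ j).ne']
    ext ⟨i, a⟩ ⟨j, b⟩
    rw [mul_mul_transpose_apply]
    simp only [hrow]
    rw [smul_dotProduct, Matrix.mulVec_smul, dotProduct_smul, hdotTi, ← hΔ]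
    fin_cases b
    · change _ • _ • ((v (i, a)).ofLp ⬝ᵥ
        T⁻¹.mulVec (Δ.mulVec (T⁻¹.mulVec (v (j, 0)).ofLp))) = Δ (i, a) (j, 0)
      rw [hv0, dotProduct_neg, dotProduct_smul, hvin, hΔ, sympForm_apply]
      by_cases hij : i = j
      · subst hij
        have h5 := hsq i
        rw [Real.sqrt_inv] at h5
        fin_cases a <;> simp <;> linear_combination h5
      · simp [hij]
    · change _ • _ • ((v (i, a)).ofLp ⬝ᵥ
        T⁻¹.mulVec (Δ.mulVec (T⁻¹.mulVec (v (j, 1)).ofLp))) = Δ (i, a) (j, 1)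
      rw [hv1, dotProduct_smul, hvin, hΔ, sympForm_apply]
      by_cases hij : i = j
      · subst hij
        have h5 := hsq i
        rw [Real.sqrt_inv] at h5
        fin_cases a <;> simp <;> linear_combination h5
      · simp [hij]
  · ext p q
    rw [mul_mul_transpose_apply]
    simp only [hrow]
    rw [smul_dotProduct, Matrix.mulVec_smul, dotProduct_smul, ← hTB', hTTx, hdotTi, hTTx', hvin,
      Matrix.diagonal_apply]
    by_cases hpq : p = q
    · subst hpq
      simp only [if_true, smul_eq_mul, mul_one]
      exact Real.mul_self_sqrt (inv_pos.mpr (hμ _)).le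
    · simp [hpq]
  · intro p hp
    have h3 := Real.sqrt_pos.mpr (hγ _ hp)
    rw [hrow, hvP p hp, hμP _ hp, inv_inv, Matrix.mulVec_smul, hTTx', smul_smul, mul_inv_cancel₀ h3.ne',
      one_smul]

theorem dotProduct_sympForm_mulVec {κ : Type} [Fintype κ] [DecidableEq κ] (x y : Phase κ → ℝ) :
    x ⬝ᵥ (sympForm κ).mulVec y = ∑ i, (x (i, 0) * y (i, 1) - x (i, 1) * y (i, 0)) := by
  have h0 : ∀ i, (sympForm κ).mulVec y (i, 0) = y (i, 1) := fun i => by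
    simp [Matrix.mulVec, dotProduct, Fintype.sum_prod_type, sympForm_apply]
  have h1 : ∀ i, (sympForm κ).mulVec y (i, 1) = -y (i, 0) := fun i => by
    simp [Matrix.mulVec, dotProduct, Fintype.sum_prod_type, sympForm_apply]
  simp only [dotProduct, Fintype.sum_prod_type, Fin.sum_univ_two, h0, h1]
  exact Finset.sum_congr rfl fun i _ => by ring

/-- The matrix -ΔSᵀΔ is a right inverse of the square matrix S, hence also a left inverse. -/
theorem IsSymplectic.transpose {κ : Type} [Fintype κ] [DecidableEq κ]
    {S : Matrix (Phase κ) (Phase κ) ℝ} (h : IsSymplectic S) :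
    S.transpose * sympForm κ * S = sympForm κ := by
  have h1 : S * (-(sympForm κ * S.transpose * sympForm κ)) = 1 := by
    rw [Matrix.mul_neg, ← Matrix.mul_assoc, ← Matrix.mul_assoc, h, sympForm_mul_self, neg_neg]
  have h2 := mul_eq_one_comm.mp h1
  have h3 : sympForm κ * (sympForm κ * S.transpose * sympForm κ * S) = -sympForm κ := by
    rw [Matrix.neg_mul, neg_eq_iff_eq_neg] at h2
    rw [h2, Matrix.mul_neg, Matrix.mul_one]
  rw [← Matrix.mul_assoc, ← Matrix.mul_assoc, ← Matrix.mul_assoc, sympForm_mul_self,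
    Matrix.neg_mul, Matrix.neg_mul, Matrix.neg_mul, Matrix.one_mul, neg_inj] at h3
  exact h3

/-! ### Mode-wise normal form of a positive definite symplectic matrix. -/

variable {n m : ℕ}

/-- The symplectic form of a bipartite system. -/
def biForm (n m : ℕ) : Matrix (Phase (Fin n) ⊕ Phase (Fin m)) (Phase (Fin n) ⊕ Phase (Fin m)) ℝ :=
  Matrix.fromBlocks (sympForm (Fin n)) 0 0 (sympForm (Fin m))

/-- The inner factors meet as SᵀΔS and the outer ones as SΔSᵀ; both equal Δ. -/
theorem biForm_conj {Γ : Matrix (Phase (Fin n) ⊕ Phase (Fin m)) (Phase (Fin n) ⊕ Phase (Fin m)) ℝ}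
    (h : Γ * biForm n m * Γ = biForm n m) {SA : Matrix (Phase (Fin n)) (Phase (Fin n)) ℝ}
    {SB : Matrix (Phase (Fin m)) (Phase (Fin m)) ℝ} (hA : IsSymplectic SA) (hB : IsSymplectic SB) :
    (Matrix.fromBlocks SA 0 0 SB * Γ * (Matrix.fromBlocks SA 0 0 SB).transpose) * biForm n m *
      (Matrix.fromBlocks SA 0 0 SB * Γ * (Matrix.fromBlocks SA 0 0 SB).transpose) =
      biForm n m := by
  set S := Matrix.fromBlocks SA 0 0 SB
  have h1 : S * biForm n m * S.transpose = biForm n m := by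
    simp only [S, biForm, Matrix.fromBlocks_transpose, Matrix.fromBlocks_multiply,
      Matrix.transpose_zero, Matrix.mul_zero, Matrix.zero_mul, add_zero, zero_add]
    rw [hA, hB]
  have h2 : S.transpose * biForm n m * S = biForm n m := by
    simp only [S, biForm, Matrix.fromBlocks_transpose, Matrix.fromBlocks_multiply,
      Matrix.transpose_zero, Matrix.mul_zero, Matrix.zero_mul, add_zero, zero_add]
    rw [hA.transpose, hB.transpose]
  calc S * Γ * S.transpose * biForm n m * (S * Γ * S.transpose)
      = S * (Γ * (S.transpose * biForm n m * S) * Γ) * S.transpose := by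
        simp only [Matrix.mul_assoc]
    _ = biForm n m := by rw [h2, h, h1]

/-- The blocks of a covariance matrix of a pure state whose `A` block is diagonal. -/
structure IsPureBlocks (γ : Fin n → ℝ) (C : Matrix (Phase (Fin n)) (Phase (Fin m)) ℝ)
    (B : Matrix (Phase (Fin m)) (Phase (Fin m)) ℝ) : Prop where
  pos : ∀ j, 0 < γ j
  posDef : B.PosDef
  rel : Matrix.fromBlocks (Matrix.diagonal fun p : Phase (Fin n) => γ p.1) C C.transpose B *
    biForm n m * Matrix.fromBlocks (Matrix.diagonal fun p : Phase (Fin n) => γ p.1) C C.transpose B =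
      biForm n m

namespace IsPureBlocks

variable {γ : Fin n → ℝ} {C : Matrix (Phase (Fin n)) (Phase (Fin m)) ℝ}
  {B : Matrix (Phase (Fin m)) (Phase (Fin m)) ℝ}

theorem blocks (h : IsPureBlocks γ C B) :
    (Matrix.diagonal fun p : Phase (Fin n) => γ p.1) * sympForm (Fin n) *
        (Matrix.diagonal fun p : Phase (Fin n) => γ p.1) + C * sympForm (Fin m) * C.transpose = sympForm (Fin n) ∧
      C.transpose * sympForm (Fin n) * (Matrix.diagonal fun p : Phase (Fin n) => γ p.1) +
        B * sympForm (Fin m) * C.transpose = 0 ∧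
      C.transpose * sympForm (Fin n) * C + B * sympForm (Fin m) * B = sympForm (Fin m) := by
  have h1 := h.rel
  simp only [biForm, Matrix.fromBlocks_multiply, Matrix.mul_zero, add_zero, zero_add] at h1
  obtain ⟨h2, -, h3, h4⟩ := Matrix.fromBlocks_inj.mp h1
  exact ⟨h2, h3, h4⟩

/-- The upper left block of the relation. Rows of C from different modes are symplectically
orthogonal, and the two rows of mode j pair to 1 - γ_j²; after rescaling they can serve as
symplectic basis vectors. -/
theorem row_form_row (h : IsPureBlocks γ C B) (p q : Phase (Fin n)) :
    C.row p ⬝ᵥ (sympForm (Fin m)).mulVec (C.row q) =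
      (1 - γ p.1 * γ q.1) * sympForm (Fin n) p q := by
  have h1 := congrFun (congrFun h.blocks.1 p) q
  rw [Matrix.add_apply, mul_mul_transpose_apply, Matrix.mul_diagonal, Matrix.diagonal_mul] at h1
  linear_combination h1

theorem mulVec_form_row (h : IsPureBlocks γ C B) (q : Phase (Fin n)) :
    B.mulVec ((sympForm (Fin m)).mulVec (C.row q)) =
      -(γ q.1 • (C.transpose * sympForm (Fin n)).col q) := by
  ext k
  have h1 := congrFun (congrFun h.blocks.2.1 k) q
  rw [Matrix.add_apply, Matrix.mul_diagonal, Matrix.mul_assoc B, Matrix.mul_apply',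
    Matrix.zero_apply] at h1
  have h2 : B.mulVec ((sympForm (Fin m)).mulVec (C.row q)) k =
      B.row k ⬝ᵥ (sympForm (Fin m) * C.transpose).col q := rfl
  rw [h2, Pi.neg_apply, Pi.smul_apply, smul_eq_mul, Matrix.col_apply]
  change _ + B.row k ⬝ᵥ (sympForm (Fin m) * C.transpose).col q = 0 at h1
  linear_combination h1

/-- From the lower left block: BΔ turns the two rows of mode j into each other with factor ±γ_j.
This and its companion supply the eigenvector relations that `exists_symplectic_diagonalization`
asks of prescribed rows. -/
theorem mulVec_form_row_zero (h : IsPureBlocks γ C B) (j : Fin n) :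
    B.mulVec ((sympForm (Fin m)).mulVec (C.row (j, 0))) = γ j • C.row (j, 1) := by
  rw [h.mulVec_form_row, ← smul_neg]
  congr 1
  ext k
  simp [Matrix.mul_apply, Fintype.sum_prod_type, sympForm_apply]

theorem mulVec_form_row_one (h : IsPureBlocks γ C B) (j : Fin n) :
    B.mulVec ((sympForm (Fin m)).mulVec (C.row (j, 1))) = -(γ j • C.row (j, 0)) := by
  rw [h.mulVec_form_row]
  congr 2
  ext k
  simp [Matrix.mul_apply, Fintype.sum_prod_type, sympForm_apply]

/-- Positivity of B enters through this value of its quadratic form: it yields γ_j ≥ 1, and γ_j = 1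
forces the rows of mode j in C to vanish. -/
theorem sq_eq (h : IsPureBlocks γ C B) (j : Fin n) :
    γ j * (γ j ^ 2 - 1) = (sympForm (Fin m)).mulVec (C.row (j, 0)) ⬝ᵥ
      B.mulVec ((sympForm (Fin m)).mulVec (C.row (j, 0))) := by
  have h1 := h.row_form_row (j, 1) (j, 0)
  rw [h.mulVec_form_row_zero, dotProduct_smul, dotProduct_comm, h1, sympForm_apply]
  simp only [if_true, Matrix.of_apply, Matrix.cons_val', Matrix.cons_val_zero, Matrix.cons_val_one,
    Matrix.cons_val_fin_one, smul_eq_mul]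
  ring

theorem one_le (h : IsPureBlocks γ C B) (j : Fin n) : 1 ≤ γ j := by
  have h1 := h.posDef.posSemidef.dotProduct_mulVec_nonneg
    ((sympForm (Fin m)).mulVec (C.row (j, 0)))
  rw [star_trivial, ← h.sq_eq j] at h1
  have h2 := nonneg_of_mul_nonneg_right h1 (h.pos j)
  nlinarith [h.pos j]

theorem row_eq_zero (h : IsPureBlocks γ C B) {j : Fin n} (hj : γ j = 1) (a : Fin 2) :
    C.row (j, a) = 0 := by
  have h1 : (sympForm (Fin m)).mulVec (C.row (j, 0)) = 0 := by
    by_contra h2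
    have h3 := h.posDef.dotProduct_mulVec_pos h2
    rw [star_trivial, ← h.sq_eq j, hj] at h3
    norm_num at h3
  have h2 : C.row (j, 0) = 0 := sympForm_mulVec_injective (h1.trans (Matrix.mulVec_zero _).symm)
  have h3 := h.mulVec_form_row_zero j
  rw [h1, Matrix.mulVec_zero, hj, one_smul] at h3
  fin_cases a
  · exact h2
  · exact h3.symm

/-- For γ_j > 1 the rows of C determine the rows of S_B; for γ_j = 1 they vanish and impose nothing.
Williamson's theorem fills in the other rows, and the lower right block of the relation identifies
the symplectic eigenvalues. -/
theorem exists_normalForm (h : IsPureBlocks γ C B) (hnm : n ≤ m) :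
    ∃ SB : Matrix (Phase (Fin m)) (Phase (Fin m)) ℝ, IsSymplectic SB ∧
      C * SB.transpose = normalFormC n m γ ∧
      SB * B * SB.transpose =
        Matrix.diagonal fun q => if h : (q.1 : ℕ) < n then γ ⟨q.1, h⟩ else 1 := by
  let g : Fin m → ℝ := fun k => if h : (k : ℕ) < n then γ ⟨k, h⟩ else 1
  have hg : ∀ i : Fin n, g (Fin.castLE hnm i) = γ i := fun i => by simp [g]
  -- Exactly the modes with σ = √(γ² - 1) > 0, where dividing by σ is legitimate; the default value
  -- 1 of `g` excludes the unpaired modes of B.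
  let P : Finset (Fin m) := Finset.univ.filter fun k => 1 < g k
  have hP : ∀ k ∈ P, ∃ i : Fin n, k = Fin.castLE hnm i ∧ 1 < γ i := by
    intro k hk
    have hk' : 1 < g k := (Finset.mem_filter.mp hk).2
    by_cases hkn : (k : ℕ) < n
    · refine ⟨⟨k, hkn⟩, rfl, ?_⟩
      simpa [g, hkn] using hk'
    · simp [g, hkn] at hk'
  set Δ := sympForm (Fin m) with hΔ
  let σ : Fin n → ℝ := fun i => √(γ i ^ 2 - 1)
  have hσ : ∀ i, 1 < γ i → 0 < σ i := fun i hi => Real.sqrt_pos.mpr (by nlinarith)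
  have hσ2 : ∀ i, σ i ^ 2 = γ i ^ 2 - 1 := fun i =>
    Real.sq_sqrt (by nlinarith [h.one_le i])
  -- Solved from the target: CSᵀ = diag(σ, -σ) on a mode requires C-row (i, a) = σ Δ s(i, 1-a), and
  -- Δ⁻¹ = -Δ. Hence the sign and the swap `Fin.rev` of the two quadratures.
  let s : Phase (Fin m) → Phase (Fin m) → ℝ := fun q =>
    if hq : (q.1 : ℕ) < n then -((σ ⟨q.1, hq⟩)⁻¹ • Δ.mulVec (C.row (⟨q.1, hq⟩, q.2.rev))) else 0
  have hsi : ∀ (i : Fin n) a,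
      s (Fin.castLE hnm i, a) = -((σ i)⁻¹ • Δ.mulVec (C.row (i, a.rev))) := fun i a => by simp [s]
  have hΔs : ∀ (i : Fin n) a, Δ.mulVec (s (Fin.castLE hnm i, a)) = (σ i)⁻¹ • C.row (i, a.rev) := by
    intro i a
    rw [hsi, Matrix.mulVec_neg, Matrix.mulVec_smul, sympForm_mulVec_mulVec, smul_neg, neg_neg]
  have hs : ∀ p q : Phase (Fin m), p.1 ∈ P → q.1 ∈ P →
      s p ⬝ᵥ Δ.mulVec (s q) = Δ p q := by
    rintro ⟨k, a⟩ ⟨l, b⟩ hk hl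
    obtain ⟨i, rfl, hi⟩ := hP k hk
    obtain ⟨j, rfl, hj⟩ := hP l hl
    have h1 := hσ i hi
    have h2 := hσ2 i
    rw [hΔs, hsi, neg_dotProduct, smul_dotProduct, dotProduct_smul, dotProduct_comm,
      h.row_form_row, sympForm_apply, hΔ, sympForm_apply]
    by_cases hij : i = j
    · subst hij
      have h3 : (σ i)⁻¹ * ((σ i)⁻¹ * (1 - γ i * γ i)) = -1 := by
        field_simp
        linear_combination h2
      fin_cases a <;> fin_cases b <;> simp [Fin.rev] <;>
        first | linear_combination h3 | linear_combination -h3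
    · have h3 : ¬ Fin.castLE hnm i = Fin.castLE hnm j := fun hh =>
        hij (Fin.castLE_injective hnm hh)
      simp [h3, Ne.symm hij]
  have h0 : ∀ j ∈ P, B.mulVec (s (j, 0)) = g j • Δ.mulVec (s (j, 1)) := by
    intro k hk
    obtain ⟨i, rfl, hi⟩ := hP k hk
    rw [hsi, hΔs, hg]
    change B.mulVec (-((σ i)⁻¹ • Δ.mulVec (C.row (i, 1)))) = γ i • (σ i)⁻¹ • C.row (i, 0)
    rw [Matrix.mulVec_neg, Matrix.mulVec_smul, h.mulVec_form_row_one, smul_neg, neg_neg, smul_comm]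
  have h1 : ∀ j ∈ P, B.mulVec (s (j, 1)) = -(g j • Δ.mulVec (s (j, 0))) := by
    intro k hk
    obtain ⟨i, rfl, hi⟩ := hP k hk
    rw [hsi, hΔs, hg]
    change B.mulVec (-((σ i)⁻¹ • Δ.mulVec (C.row (i, 0)))) = -(γ i • (σ i)⁻¹ • C.row (i, 1))
    rw [Matrix.mulVec_neg, Matrix.mulVec_smul, h.mulVec_form_row_zero, smul_comm]
  obtain ⟨S, β, hS, hβ, hSB, hSP⟩ := exists_symplectic_diagonalization h.posDef P s g
    (fun k hk => zero_lt_one.trans (Finset.mem_filter.mp hk).2) hs h0 h1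
  have hC : C * S.transpose = normalFormC n m γ := by
    ext ⟨i, a⟩ ⟨k, b⟩
    have h1 : (C * S.transpose) (i, a) (k, b) = C.row (i, a) ⬝ᵥ S.row (k, b) := rfl
    have h2 : normalFormC n m γ (i, a) (k, b) =
        if (i : ℕ) = (k : ℕ) ∧ a = b then (if a = 0 then σ i else -σ i) else 0 := rfl
    rw [h1, h2]
    by_cases hi : γ i = 1
    · have h3 : σ i = 0 := by simp [σ, hi]
      rw [h.row_eq_zero hi, zero_dotProduct, h3]
      simp
    · have hi1 : 1 < γ i := lt_of_le_of_ne (h.one_le i) (Ne.symm hi)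
      have h3 : Δ.mulVec (S.row (Fin.castLE hnm i, a.rev)) = (σ i)⁻¹ • C.row (i, a) := by
        rw [hSP _ (Finset.mem_filter.mpr ⟨Finset.mem_univ _, by rwa [hg]⟩), hΔs, Fin.rev_rev]
      have h4 : C.row (i, a) = σ i • Δ.mulVec (S.row (Fin.castLE hnm i, a.rev)) := by
        rw [h3, smul_smul, mul_inv_cancel₀ (hσ i hi1).ne', one_smul]
      rw [h4, smul_dotProduct, dotProduct_comm, ← mul_mul_transpose_apply, hS, sympForm_apply]
      have h5 : k = Fin.castLE hnm i ↔ (i : ℕ) = (k : ℕ) := by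
        rw [Fin.ext_iff]; exact eq_comm
      simp only [h5, smul_eq_mul]
      by_cases hik : (i : ℕ) = (k : ℕ)
      · fin_cases a <;> fin_cases b <;> simp [hik, Fin.rev]
      · simp [hik]
  refine ⟨S, hS, hC, ?_⟩
  rw [hSB]
  congr 1
  funext q
  change β q.1 = g q.1
  obtain ⟨k, b⟩ := q
  -- Williamson's theorem leaves `β` unspecified. The ((k,0),(k,1)) entry of the transformed
  -- relation reads (1 - γ_k²) + β_k² = 1 for a paired mode and β_k² = 1 for an unpaired one.
  have h1 := biForm_conj h.rel (SA := 1) (SB := S) (by simp [IsSymplectic]) hS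
  simp only [biForm, Matrix.fromBlocks_transpose, Matrix.fromBlocks_multiply,
    Matrix.transpose_zero, Matrix.mul_zero, Matrix.zero_mul, add_zero, zero_add,
    Matrix.one_mul, Matrix.transpose_one, Matrix.mul_one] at h1
  rw [hSB, hC] at h1
  have h2 := congrFun (congrFun (Matrix.fromBlocks_inj.mp h1).2.2.2 (k, 0)) (k, 1)
  rw [← Matrix.transpose_transpose (normalFormC n m γ)] at h2
  have hC' : S * C.transpose = (normalFormC n m γ).transpose := by
    rw [← hC, Matrix.transpose_mul, Matrix.transpose_transpose]
  rw [Matrix.transpose_transpose (normalFormC n m γ), hC', Matrix.add_apply] at h2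
  nth_rewrite 2 [← Matrix.transpose_transpose (normalFormC n m γ)] at h2
  rw [mul_mul_transpose_apply, dotProduct_sympForm_mulVec, Matrix.mul_diagonal,
    Matrix.diagonal_mul, sympForm_apply] at h2
  have h3 : ∀ i : Fin n, (normalFormC n m γ).transpose.row (k, 0) (i, 0) *
      (normalFormC n m γ).transpose.row (k, 1) (i, 1) -
      (normalFormC n m γ).transpose.row (k, 0) (i, 1) *
      (normalFormC n m γ).transpose.row (k, 1) (i, 0) =
      if (i : ℕ) = (k : ℕ) then 1 - γ i ^ 2 else 0 := by
    intro i
    have h5 := hσ2 i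
    simp only [Matrix.row_apply, Matrix.transpose_apply, normalFormC, Matrix.of_apply]
    by_cases hik : (i : ℕ) = (k : ℕ)
    · simp [hik]
      simp only [σ] at h5
      linear_combination -h5
    · simp [hik]
  rw [Finset.sum_congr rfl fun i _ => h3 i] at h2
  have h4 : β k ^ 2 = g k ^ 2 := by
    by_cases hkn : (k : ℕ) < n
    · have h6 : ∑ i : Fin n, (if (i : ℕ) = (k : ℕ) then 1 - γ i ^ 2 else 0) =
          1 - γ ⟨k, hkn⟩ ^ 2 := by
        rw [Finset.sum_eq_single ⟨k, hkn⟩]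
        · simp
        · intro i _ hi
          rw [if_neg fun hh => hi (Fin.ext hh)]
        · simp
      rw [h6] at h2
      simp at h2
      simp [g, hkn]
      linear_combination h2
    · have h6 : ∑ i : Fin n, (if (i : ℕ) = (k : ℕ) then 1 - γ i ^ 2 else 0) = 0 :=
        Finset.sum_eq_zero fun i _ => if_neg fun hh : (i : ℕ) = k => hkn (hh ▸ i.2)
      rw [h6] at h2
      have hgk : g k = 1 := by simp [g, hkn]
      rw [hgk]
      simp only [if_true, Matrix.of_apply, Matrix.cons_val', Matrix.cons_val_zero,
        Matrix.cons_val_one, Matrix.cons_val_fin_one] at h2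
      linear_combination h2
  have hgk : 0 < g k := by
    by_cases hkn : (k : ℕ) < n
    · simpa [g, hkn] using h.pos _
    · simp [g, hkn]
  exact (pow_left_inj₀ (hβ k).le hgk.le two_ne_zero).mp h4

end IsPureBlocks

/-- A positive definite symplectic matrix is brought to the mode-wise normal form by a local
symplectic matrix. -/
theorem exists_modewise_normalForm (hnm : n ≤ m)
    {Γ : Matrix (Phase (Fin n) ⊕ Phase (Fin m)) (Phase (Fin n) ⊕ Phase (Fin m)) ℝ}
    (hpd : Γ.PosDef) (hΓ : Γ * biForm n m * Γ = biForm n m) :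
    ∃ γ : Fin n → ℝ, (∀ j, 1 ≤ γ j) ∧
      ∃ (SA : Matrix (Phase (Fin n)) (Phase (Fin n)) ℝ)
        (SB : Matrix (Phase (Fin m)) (Phase (Fin m)) ℝ), IsSymplectic SA ∧ IsSymplectic SB ∧
        Matrix.fromBlocks SA 0 0 SB * Γ * (Matrix.fromBlocks SA 0 0 SB).transpose =
          normalForm n m γ := by
  obtain ⟨A, C, D, B, rfl⟩ : ∃ A C D B, Γ = Matrix.fromBlocks A C D B :=
    ⟨_, _, _, _, (Matrix.fromBlocks_toBlocks Γ).symm⟩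
  have hD : D = C.transpose := by
    have h1 := hpd.isHermitian
    rw [Matrix.IsHermitian, Matrix.conjTranspose_eq_transpose_of_trivial,
      Matrix.fromBlocks_transpose] at h1
    exact (Matrix.fromBlocks_inj.mp h1).2.2.1.symm
  subst hD
  have hA : A.PosDef := hpd.submatrix Sum.inl_injective
  have hB : B.PosDef := hpd.submatrix Sum.inr_injective
  -- With `P = ∅` nothing is prescribed; the symplectic eigenvalues of A become the mixedness
  -- factors.
  obtain ⟨SA, γ, hSA, hγ, hSAA, -⟩ := exists_symplectic_diagonalization hA ∅ (fun _ _ => 0) 0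
    (by simp) (by simp) (by simp) (by simp)
  have h1 := biForm_conj hΓ hSA (SB := 1) (by simp [IsSymplectic])
  simp only [Matrix.fromBlocks_transpose, Matrix.fromBlocks_multiply,
      Matrix.transpose_zero, Matrix.mul_zero, Matrix.zero_mul, add_zero, zero_add,
      Matrix.one_mul, Matrix.transpose_one, Matrix.mul_one, hSAA] at h1
  have hP : IsPureBlocks γ (SA * C) B :=
    ⟨hγ, hB, by rw [Matrix.transpose_mul]; exact h1⟩
  obtain ⟨SB, hSB, hSC, hSBB⟩ := hP.exists_normalForm hnm
  refine ⟨γ, hP.one_le, SA, SB, hSA, hSB, ?_⟩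
  simp only [normalForm, Matrix.fromBlocks_transpose, Matrix.fromBlocks_multiply,
      Matrix.transpose_zero, Matrix.mul_zero, Matrix.zero_mul, add_zero, zero_add]
  rw [hSAA, hSBB, hSC, ← hSC, Matrix.transpose_mul, Matrix.transpose_mul,
    Matrix.transpose_transpose, Matrix.mul_assoc SB]

end CV

/-! ### Fourier uniqueness, characteristic functions and Gaussian integrals. -/

open scoped FourierTransform in
/-- The Fourier transform is injective on integrable functions. -/
theorem ae_eq_of_fourier_eq {V : Type*} [NormedAddCommGroup V] [InnerProductSpace ℝ V]
    [FiniteDimensional ℝ V] [MeasurableSpace V] [BorelSpace V] {f g : V → ℂ}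
    (hf : Integrable f) (hg : Integrable g) (h : ∀ w, 𝓕 f w = 𝓕 g w) : f =ᵐ[volume] g := by
  have key := ae_eq_zero_of_integral_contDiff_smul_eq_zero (μ := volume)
    (hf.sub hg).locallyIntegrable ?_
  · filter_upwards [key] with t ht
    exact sub_eq_zero.mp ht
  · intro φ hφ hc
    have hφ' : ContDiff ℝ ∞ fun x => (φ x : ℂ) := Complex.ofRealCLM.contDiff.comp hφ
    have hc' : HasCompactSupport fun x => (φ x : ℂ) := hc.comp_left Complex.ofReal_zero
    let Φ : SchwartzMap V ℂ := hc'.toSchwartzMap hφ'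
    have hΦ : ∀ x, 𝓕 (𝓕⁻ Φ) x = (φ x : ℂ) := fun x => by
      rw [FourierTransform.fourier_fourierInv_eq]; rfl
    have hz : ∀ w, 𝓕 (f - g) w = 0 := fun w => by
      have h2 := h w
      simp only [Real.fourier_eq, Pi.sub_apply, smul_sub] at h2 ⊢
      rw [integral_sub ((Real.fourierIntegral_convergent_iff w).2 hf)
        ((Real.fourierIntegral_convergent_iff w).2 hg), h2, sub_self]
    -- The test function is itself a Fourier transform, so the multiplication formula moves the
    -- transform onto `f - g`, where it vanishes.
    have h3 : ∫ ξ, 𝓕 (𝓕⁻ Φ) ξ • (f - g) ξ = ∫ x, (𝓕⁻ Φ) x • 𝓕 (f - g) x := by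
      have := VectorFourier.integral_fourierIntegral_smul_eq_flip (L := innerₗ V) (μ := volume)
        (ν := volume) Real.continuous_fourierChar continuous_inner (𝓕⁻ Φ).integrable (hf.sub hg)
      rwa [flip_innerₗ] at this
    simp only [hz, smul_zero, integral_zero, hΦ] at h3
    simpa using! h3

namespace CV

variable {ι : Type} [Fintype ι]

/-- The characteristic function of a pure state. -/
theorem charFn_eq_inner {ρ : State ι} {ψ : Space ι} (h : ∀ φ, ρ.op φ = ⟪ψ, φ⟫_ℂ • ψ)
    (z : Phase ι → ℝ) : ρ.charFn z = ⟪ψ, weyl z ψ⟫_ℂ := by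
  let b := basis (Space ι)
  let W := (weyl z).toContinuousLinearMap
  -- In this form Parseval's identity sums the trace series.
  have h1 : ∀ i, ⟪b i, (ρ.op ∘L W) (b i)⟫_ℂ =
      ⟪ContinuousLinearMap.adjoint W ψ, b i⟫_ℂ * ⟪b i, ψ⟫_ℂ := fun i => by
    rw [ContinuousLinearMap.comp_apply, h, inner_smul_right, ContinuousLinearMap.adjoint_inner_left]
  change ∑' i, ⟪b i, (ρ.op ∘L W) (b i)⟫_ℂ = _
  simp_rw [h1]
  rw [b.tsum_inner_mul_inner, ContinuousLinearMap.adjoint_inner_left]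
  rfl

theorem inner_weyl (ψ : Space ι) (z : Phase ι → ℝ) :
    ⟪ψ, weyl z ψ⟫_ℂ = ∫ t, star (ψ t) * (weylPhase z t * ψ (t + shift z)) := by
  rw [L2.inner_def]
  refine integral_congr_ae ?_
  filter_upwards [(memLp_weyl z ψ).coeFn_toLp] with t ht
  change ⟪ψ t, ((memLp_weyl z ψ).toLp _ : Space ι) t⟫_ℂ = _
  rw [ht, RCLike.inner_apply, mul_comm]
  rfl

theorem fourier_eq_integral_dotProduct (f : Config ι → ℂ) (w : Config ι) :
    FourierTransform.fourier f w =
      ∫ t : Config ι, Complex.exp (Complex.I * (((-(2 * Real.pi)) • w.ofLp ⬝ᵥ t.ofLp : ℝ) : ℂ)) * f t := by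
  rw [Real.fourier_eq']
  refine integral_congr_ae (.of_forall fun t => ?_)
  simp only [smul_eq_mul]
  congr 2
  rw [EuclideanSpace.inner_eq_star_dotProduct, star_trivial, smul_dotProduct, smul_eq_mul]
  push_cast
  ring

theorem ae_eq_of_integral_exp_eq {f g : Config ι → ℂ} (hf : Integrable f) (hg : Integrable g)
    (h : ∀ x : ι → ℝ, ∫ t : Config ι, Complex.exp (Complex.I * ((x ⬝ᵥ t.ofLp : ℝ) : ℂ)) * f t =
      ∫ t : Config ι, Complex.exp (Complex.I * ((x ⬝ᵥ t.ofLp : ℝ) : ℂ)) * g t) :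
    f =ᵐ[volume] g :=
  ae_eq_of_fourier_eq hf hg fun w => by
    rw [fourier_eq_integral_dotProduct, fourier_eq_integral_dotProduct, h]

variable [DecidableEq ι]

/-- The substitution u = T⁻¹t with T² = A reduces to the standard Gaussian. The normalization `c`
stays implicit, since only c ≠ 0 and its independence of x matter. -/
theorem exists_gaussian_integral {A : Matrix ι ι ℝ} (hA : A.PosDef) :
    ∃ c : ℂ, c ≠ 0 ∧ ∀ x : ι → ℝ,
      ∫ t : Config ι, Complex.exp (Complex.I * ((x ⬝ᵥ t.ofLp : ℝ) : ℂ)) *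
        (c * Complex.exp (-((t.ofLp ⬝ᵥ A⁻¹.mulVec t.ofLp : ℝ) : ℂ))) =
      Complex.exp (-(1 / 4) * ((x ⬝ᵥ A.mulVec x : ℝ) : ℂ)) := by
  obtain ⟨T, hT, hTA, hTu⟩ := hA.exists_symm_sqrt
  have hTi : T⁻¹.transpose = T⁻¹ := by rw [Matrix.transpose_nonsing_inv, hT]
  have hdotT : ∀ x y, T.mulVec x ⬝ᵥ y = x ⬝ᵥ T.mulVec y := fun x y => by
    rw [Matrix.dotProduct_mulVec, ← Matrix.mulVec_transpose, hT]
  have hdotTi : ∀ x y, T⁻¹.mulVec x ⬝ᵥ y = x ⬝ᵥ T⁻¹.mulVec y := fun x y => by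
    rw [Matrix.dotProduct_mulVec, ← Matrix.mulVec_transpose, hTi]
  let L : Config ι →ₗ[ℝ] Config ι := Matrix.toEuclideanLin T⁻¹
  have hLap : ∀ t, (L t).ofLp = T⁻¹.mulVec t.ofLp := fun t => rfl
  have hLdet : LinearMap.det L ≠ 0 := by
    have h1 : L ∘ₗ Matrix.toEuclideanLin T = LinearMap.id := by
      refine LinearMap.ext fun t => ?_
      refine WithLp.ofLp_injective 2 ?_
      change T⁻¹.mulVec (T.mulVec t.ofLp) = t.ofLp
      rw [Matrix.mulVec_mulVec, Matrix.nonsing_inv_mul T hTu, Matrix.one_mulVec]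
    have h2 := congrArg LinearMap.det h1
    rw [LinearMap.det_comp, LinearMap.det_id] at h2
    exact left_ne_zero_of_mul_eq_one h2
  have hmap := Measure.map_linearMap_addHaar_eq_smul_addHaar (volume : Measure (Config ι)) hLdet
  have hcomp : ∀ F : Config ι → ℂ, Continuous F →
      ∫ t, F (L t) = |(LinearMap.det L)⁻¹| • ∫ u, F u := by
    intro F hF
    rw [← integral_map (LinearMap.continuous_of_finiteDimensional L).aemeasurable
      hF.aestronglyMeasurable, hmap, integral_smul_measure,
      ENNReal.toReal_ofReal (abs_nonneg _)]
  have hint : ∀ x : ι → ℝ, ∫ u : Config ι,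
      Complex.exp (-(1 : ℂ) * ‖u‖ ^ 2 + Complex.I * ⟪WithLp.toLp 2 (T.mulVec x), u⟫_ℝ) =
      (Real.pi / 1 : ℂ) ^ (Module.finrank ℝ (Config ι) / 2 : ℂ) *
        Complex.exp (-(1 / 4) * ((x ⬝ᵥ A.mulVec x : ℝ) : ℂ)) := by
    intro x
    rw [GaussianFourier.integral_cexp_neg_mul_sq_norm_add (by simp)]
    congr 2
    rw [← Complex.ofReal_pow, ← real_inner_self_eq_norm_sq, EuclideanSpace.inner_toLp_toLp,
      star_trivial, hdotT, Matrix.mulVec_mulVec, hTA, Complex.I_sq]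
    ring
  have hpi : (Real.pi / 1 : ℂ) ^ (Module.finrank ℝ (Config ι) / 2 : ℂ) ≠ 0 := by
    rw [Complex.cpow_ne_zero_iff]
    left
    simp [Real.pi_ne_zero]
  have hdet0 : ((|(LinearMap.det L)⁻¹| : ℝ) : ℂ) ≠ 0 := by
    rw [Complex.ofReal_ne_zero, abs_ne_zero]
    exact inv_ne_zero hLdet
  refine ⟨(((|(LinearMap.det L)⁻¹| : ℝ) : ℂ) *
    (Real.pi / 1 : ℂ) ^ (Module.finrank ℝ (Config ι) / 2 : ℂ))⁻¹,
    inv_ne_zero (mul_ne_zero hdet0 hpi), fun x => ?_⟩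
  have h1 := hcomp (fun u => Complex.exp (-(1 : ℂ) * ‖u‖ ^ 2 +
    Complex.I * ⟪WithLp.toLp 2 (T.mulVec x), u⟫_ℝ)) (by fun_prop)
  rw [hint x] at h1
  simp_rw [mul_left_comm (Complex.exp _)]
  rw [integral_const_mul, inv_mul_eq_iff_eq_mul₀ (mul_ne_zero hdet0 hpi), mul_assoc]
  rw [Complex.real_smul] at h1
  rw [← h1]
  refine integral_congr_ae (.of_forall fun t => ?_)
  simp only
  rw [← Complex.exp_add]
  congr 1
  rw [← Complex.ofReal_pow, ← real_inner_self_eq_norm_sq,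
    EuclideanSpace.inner_eq_star_dotProduct, EuclideanSpace.inner_eq_star_dotProduct,
    star_trivial, star_trivial, hLap, hdotTi, Matrix.mulVec_mulVec, ← Matrix.mul_inv_rev, hTA,
    dotProduct_comm (T⁻¹.mulVec _), hdotT, Matrix.mulVec_mulVec, Matrix.mul_nonsing_inv T hTu,
    Matrix.one_mulVec]
  ring

end CV

/-- Differentiate at s = 0. A single s would leave the ambiguity of multiples of 2πi. -/
theorem eq_zero_of_forall_exp_smul_eq_one {β : ℂ} (h : ∀ s : ℝ, Complex.exp (s * β) = 1) :
    β = 0 := by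
  have h1 : HasDerivAt (fun s : ℝ => Complex.exp (s * β)) (Complex.exp ((0 : ℝ) * β) * (1 * β)) 0 :=
    ((Complex.ofRealCLM.hasDerivAt (x := (0 : ℝ))).mul_const β).cexp
  have h2 : HasDerivAt (fun s : ℝ => Complex.exp (s * β)) 0 0 := by
    simp_rw [h]
    exact hasDerivAt_const _ _
  have h3 := h1.unique h2
  simpa using h3

theorem Matrix.eq_of_forall_dotProduct_mulVec {κ : Type*} [Fintype κ] [DecidableEq κ]
    {X Y : Matrix κ κ ℝ} (h : ∀ x y : κ → ℝ, x ⬝ᵥ X.mulVec y = x ⬝ᵥ Y.mulVec y) : X = Y := by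
  ext i j
  simpa using h (Pi.single i 1) (Pi.single j 1)

/-! ### The autocorrelation of a Gaussian wave function. -/

namespace CV

variable {ι : Type} [Fintype ι]

/-- The phase space point with position part `x` and momentum part `y`. -/
def phasePoint (x y : ι → ℝ) : Phase ι → ℝ := fun p => if p.2 = 0 then x p.1 else y p.1

theorem integral_exp_overlap (ψ : Space ι) (x y : ι → ℝ) :
    ∫ t : Config ι, Complex.exp (Complex.I * ((x ⬝ᵥ t.ofLp : ℝ) : ℂ)) *
      (star (ψ t) * ψ (t + WithLp.toLp 2 y)) =
      Complex.exp (-(Complex.I * ((x ⬝ᵥ y : ℝ) : ℂ) / 2)) * ⟪ψ, weyl (phasePoint x y) ψ⟫_ℂ := by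
  rw [inner_weyl, ← integral_const_mul]
  refine integral_congr_ae (.of_forall fun t => ?_)
  have h1 : shift (phasePoint x y) = WithLp.toLp 2 y := by
    simp [shift, phasePoint]
  have h2 : weylPhase (phasePoint x y) t = Complex.exp (Complex.I * ((x ⬝ᵥ y : ℝ) : ℂ) / 2) *
      Complex.exp (Complex.I * ((x ⬝ᵥ t.ofLp : ℝ) : ℂ)) := by
    rw [← Complex.exp_add]
    simp only [weylPhase, phasePoint, if_true, dotProduct, one_ne_zero, if_false]
    congr 1
    push_cast
    ring
  simp only
  rw [h1, h2]
  have h3 : Complex.exp (-(Complex.I * ((x ⬝ᵥ y : ℝ) : ℂ) / 2)) *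
      Complex.exp (Complex.I * ((x ⬝ᵥ y : ℝ) : ℂ) / 2) = 1 := by
    rw [← Complex.exp_add, neg_add_cancel, Complex.exp_zero]
  linear_combination (-(Complex.exp (Complex.I * ((x ⬝ᵥ t.ofLp : ℝ) : ℂ)) *
      (star (ψ t) * ψ (t + WithLp.toLp 2 y)))) * h3

/-- The autocorrelation function of a wave function is integrable. -/
theorem integrable_overlap (ψ : Space ι) (y : ι → ℝ) :
    Integrable fun t : Config ι => star (ψ t) * ψ (t + WithLp.toLp 2 y) := by
  have h1 := (Lp.memLp ψ).star
  have h2 := (Lp.memLp ψ).comp_measurePreserving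
    (measurePreserving_add_right (volume : Measure (Config ι)) (WithLp.toLp 2 y))
  exact h1.integrable_mul h2

/-- The real part of a Gaussian exponent is non-positive, as Weyl operators are isometries. -/
theorem posSemidef_of_charFn {Γ : Matrix (Phase ι) (Phase ι) ℝ} (hΓ : Γ.transpose = Γ)
    {d : Phase ι → ℝ} {ψ : Space ι} (hψ : ‖ψ‖ = 1)
    (h : ∀ z, ⟪ψ, weyl z ψ⟫_ℂ = Complex.exp (-(1 / 4 : ℂ) * ((z ⬝ᵥ Γ.mulVec z : ℝ) : ℂ) +
      Complex.I * ((d ⬝ᵥ z : ℝ) : ℂ))) : Γ.PosSemidef := by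
  refine Matrix.PosSemidef.of_dotProduct_mulVec_nonneg ?_ fun z => ?_
  · rwa [Matrix.IsHermitian, Matrix.conjTranspose_eq_transpose_of_trivial]
  · have h1 := norm_inner_le_norm (𝕜 := ℂ) ψ (weyl z ψ)
    rw [(weyl z).norm_map, hψ, h, Complex.norm_exp, mul_one, Real.exp_le_one_iff] at h1
    have h2 : (-(1 / 4 : ℂ) * ((z ⬝ᵥ Γ.mulVec z : ℝ) : ℂ) +
        Complex.I * ((d ⬝ᵥ z : ℝ) : ℂ)).re = -(1 / 4) * (z ⬝ᵥ Γ.mulVec z) := by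
      rw [Complex.add_re, Complex.I_mul_re, Complex.ofReal_im, neg_zero, add_zero,
        show (-(1 / 4 : ℂ)) = ((-(1 / 4) : ℝ) : ℂ) by push_cast; rfl, Complex.re_ofReal_mul,
        Complex.ofReal_re]
    rw [h2] at h1
    rw [star_trivial]
    linarith

open Filter Topology in
/-- The position distribution of a wave function is absolutely continuous, so its characteristic
function does not have modulus one along a line. -/
theorem exists_norm_inner_weyl_ne_one (ψ : Space ι) {x : ι → ℝ} (hx : x ≠ 0) :
    ∃ s : ℝ, ‖⟪ψ, weyl (phasePoint (s • x) 0) ψ⟫_ℂ‖ ≠ 1 := by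
  by_contra! hc
  -- Riemann–Lebesgue applied to |ψ|²: its transform tends to 0 along the line through `x`, whereas
  -- the negated goal keeps its modulus equal to 1.
  let f : Config ι → ℂ := fun t => star (ψ t) * ψ (t + WithLp.toLp 2 0)
  have h1 := tendsto_integral_exp_inner_smul_cocompact f
  have h2 : Tendsto (fun s : ℝ => s • (WithLp.toLp 2 x : Config ι)) atTop
      (cocompact (Config ι)) := by
    rw [← Metric.cobounded_eq_cocompact, ← tendsto_norm_atTop_iff_cobounded]
    simp_rw [norm_smul]
    have : 0 < ‖(WithLp.toLp 2 x : Config ι)‖ := norm_pos_iff.mpr fun h0 =>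
      hx (WithLp.toLp_injective 2 h0)
    exact tendsto_abs_atTop_atTop.atTop_mul_const this
  have h3 := (h1.comp h2).norm
  have h4 : ∀ s : ℝ, ‖∫ v, Real.fourierChar (-⟪v, s • (WithLp.toLp 2 x : Config ι)⟫_ℝ) • f v‖ = 1 := by
    intro s
    have h5 := fourier_eq_integral_dotProduct f (s • (WithLp.toLp 2 x : Config ι))
    rw [Real.fourier_eq] at h5
    rw [h5]
    have h6 := integral_exp_overlap ψ ((-(2 * Real.pi)) • (s • x)) 0
    have h7 : (s • (WithLp.toLp 2 x : Config ι)).ofLp = s • x := rfl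
    rw [h7, h6, norm_mul, smul_smul, hc, dotProduct_zero]
    simp
  have h8 : Tendsto (fun _ : ℝ => (1 : ℝ)) atTop (𝓝 ‖(0 : ℂ)‖) := by
    refine h3.congr fun s => ?_
    exact h4 s
  rw [norm_zero] at h8
  exact one_ne_zero (tendsto_nhds_unique tendsto_const_nhds h8)

section Gaussian

variable [DecidableEq ι]

variable {A B C : Matrix ι ι ℝ} {a b : ι → ℝ} {ψ : Space ι}

/-- The exponent of the autocorrelation function of a Gaussian wave function. -/
noncomputable def overlapExponent (A B C : Matrix ι ι ℝ) (a b y t : ι → ℝ) : ℂ :=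
  -(((t + (1 / 2 : ℝ) • y - a) ⬝ᵥ A⁻¹.mulVec (t + (1 / 2 : ℝ) • y - a) : ℝ) : ℂ) +
    Complex.I * (((A⁻¹ * C).mulVec y ⬝ᵥ (t + (1 / 2 : ℝ) • y - a) : ℝ) : ℂ) +
    (-(1 / 4) * ((y ⬝ᵥ (B - C.transpose * A⁻¹ * C).mulVec y : ℝ) : ℂ) +
      Complex.I * ((b ⬝ᵥ y : ℝ) : ℂ))

theorem continuous_overlapExponent (y : ι → ℝ) :
    Continuous fun t : Config ι => overlapExponent A B C a b y t.ofLp := by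
  unfold overlapExponent
  have h1 : Continuous fun t : Config ι => t.ofLp + (1 / 2 : ℝ) • y - a := by fun_prop
  have h2 : Continuous fun t : Config ι => A⁻¹.mulVec (t.ofLp + (1 / 2 : ℝ) • y - a) :=
    Continuous.matrix_mulVec continuous_const h1
  have h3 := h1.dotProduct h2
  have h4 : Continuous fun t : Config ι =>
    (A⁻¹ * C).mulVec y ⬝ᵥ (t.ofLp + (1 / 2 : ℝ) • y - a) := continuous_const.dotProduct h1
  fun_prop

/-- Completing the square in x: with N = A⁻¹Cy the exponent becomes the A-form of x + N plus the
Schur complement form of y. Inverting the Gaussian transform therefore gives a Gaussian modulated by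
N and centred at a - y/2. It is essential that `c` does not depend on y. -/
theorem ae_overlap_eq (hA : A.PosDef)
    (h : ∀ x y : ι → ℝ, ⟪ψ, weyl (phasePoint x y) ψ⟫_ℂ = Complex.exp (-(1 / 4 : ℂ) *
      ((x ⬝ᵥ A.mulVec x + 2 * (x ⬝ᵥ C.mulVec y) + y ⬝ᵥ B.mulVec y : ℝ) : ℂ) +
      Complex.I * ((a ⬝ᵥ x + b ⬝ᵥ y : ℝ) : ℂ))) :
    ∃ c : ℂ, c ≠ 0 ∧ ∀ y : ι → ℝ, (fun t : Config ι => star (ψ t) * ψ (t + WithLp.toLp 2 y))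
      =ᵐ[volume] fun t => c * Complex.exp (overlapExponent A B C a b y t.ofLp) := by
  obtain ⟨c, hc, hcx⟩ := exists_gaussian_integral hA
  refine ⟨c, hc, fun y => ?_⟩
  have hAT : A.transpose = A := by
    have := hA.isHermitian
    rwa [Matrix.IsHermitian, Matrix.conjTranspose_eq_transpose_of_trivial] at this
  have hAi : A * A⁻¹ = 1 :=
    Matrix.mul_nonsing_inv A ((Matrix.isUnit_iff_isUnit_det A).mp hA.isUnit)
  have key : ∀ x : ι → ℝ, ∫ t : Config ι, Complex.exp (Complex.I * ((x ⬝ᵥ t.ofLp : ℝ) : ℂ)) *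
      (c * Complex.exp (overlapExponent A B C a b y t.ofLp)) =
      Complex.exp (-(Complex.I * ((x ⬝ᵥ y : ℝ) : ℂ) / 2)) * ⟪ψ, weyl (phasePoint x y) ψ⟫_ℂ := by
    intro x
    rw [← integral_sub_right_eq_self _
      (WithLp.toLp 2 ((1 / 2 : ℝ) • y - a) : Config ι)]
    set N := (A⁻¹ * C).mulVec y with hN
    have h1 : ∀ t : Config ι,
        Complex.exp (Complex.I *
          ((x ⬝ᵥ (t - WithLp.toLp 2 ((1 / 2 : ℝ) • y - a)).ofLp : ℝ) : ℂ)) *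
        (c * Complex.exp (overlapExponent A B C a b y
          (t - WithLp.toLp 2 ((1 / 2 : ℝ) • y - a)).ofLp)) =
        Complex.exp (-(Complex.I * ((x ⬝ᵥ y : ℝ) : ℂ) / 2) + Complex.I * ((a ⬝ᵥ x : ℝ) : ℂ) +
          (-(1 / 4) * ((y ⬝ᵥ (B - C.transpose * A⁻¹ * C).mulVec y : ℝ) : ℂ) +
          Complex.I * ((b ⬝ᵥ y : ℝ) : ℂ))) *
        (Complex.exp (Complex.I * (((x + N) ⬝ᵥ t.ofLp : ℝ) : ℂ)) *
          (c * Complex.exp (-((t.ofLp ⬝ᵥ A⁻¹.mulVec t.ofLp : ℝ) : ℂ)))) := by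
      intro t
      have h2 : (t - WithLp.toLp 2 ((1 / 2 : ℝ) • y - a)).ofLp =
        t.ofLp - ((1 / 2 : ℝ) • y - a) := rfl
      have h3 : t.ofLp - ((1 / 2 : ℝ) • y - a) + (1 / 2 : ℝ) • y - a = t.ofLp := by abel
      rw [overlapExponent, h2, h3, ← hN]
      rw [mul_left_comm _ c, mul_left_comm _ c, mul_left_comm _ c, ← Complex.exp_add,
        ← Complex.exp_add, ← Complex.exp_add, dotProduct_sub, dotProduct_sub, dotProduct_smul,
        add_dotProduct, dotProduct_comm a x, smul_eq_mul]
      congr 2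
      push_cast
      ring
    simp_rw [h1]
    rw [integral_const_mul, hcx, h, ← Complex.exp_add, ← Complex.exp_add]
    congr 1
    have h4 : x ⬝ᵥ A.mulVec N = x ⬝ᵥ C.mulVec y := by
      rw [hN, Matrix.mulVec_mulVec, ← Matrix.mul_assoc, hAi, Matrix.one_mul]
    have h5 : N ⬝ᵥ A.mulVec x = x ⬝ᵥ C.mulVec y := by
      rw [← h4, Matrix.dotProduct_mulVec, ← Matrix.mulVec_transpose, hAT, dotProduct_comm]
    have h6 : N ⬝ᵥ A.mulVec N = y ⬝ᵥ (C.transpose * A⁻¹ * C).mulVec y := by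
      rw [hN, Matrix.mulVec_mulVec, ← Matrix.mul_assoc, hAi, Matrix.one_mul, dotProduct_comm,
        Matrix.mul_assoc, ← Matrix.mulVec_mulVec y C.transpose, Matrix.dotProduct_mulVec y,
        Matrix.vecMul_transpose]
    rw [Matrix.mulVec_add, dotProduct_add, add_dotProduct, add_dotProduct, h4, h5, h6,
      Matrix.sub_mulVec, dotProduct_sub]
    push_cast
    ring
  refine ae_eq_of_integral_exp_eq (integrable_overlap ψ y) ?_ fun x => ?_
  -- A non-integrable function has integral 0 by convention, while `key` at x = 0 gives an
  -- exponential.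
  · refine Integrable.of_integral_ne_zero ?_
    have h1 := key 0
    rw [h] at h1
    simp only [zero_dotProduct, Complex.ofReal_zero, mul_zero, Complex.exp_zero, one_mul] at h1
    rw [h1]
    simp
  · rw [key, integral_exp_overlap]

/-- With F(t, y) = conj ψ(t)·ψ(t+y), both F(t, y)F(t+y, y') and F(t+y, 0)F(t, y+y') are the same
product of four values of ψ. Substituting the Gaussian form of F, the real part of the exponents
gives the first relation and the imaginary part the second. -/
theorem relations_of_charFn (hA : A.PosDef)
    (h : ∀ x y : ι → ℝ, ⟪ψ, weyl (phasePoint x y) ψ⟫_ℂ = Complex.exp (-(1 / 4 : ℂ) *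
      ((x ⬝ᵥ A.mulVec x + 2 * (x ⬝ᵥ C.mulVec y) + y ⬝ᵥ B.mulVec y : ℝ) : ℂ) +
      Complex.I * ((a ⬝ᵥ x + b ⬝ᵥ y : ℝ) : ℂ))) (hB : B.transpose = B) :
    B - C.transpose * A⁻¹ * C = A⁻¹ ∧ (A⁻¹ * C).transpose = A⁻¹ * C := by
  obtain ⟨c, hc, hov⟩ := ae_overlap_eq hA h
  have hAT : A.transpose = A := by
    have := hA.isHermitian
    rwa [Matrix.IsHermitian, Matrix.conjTranspose_eq_transpose_of_trivial] at this
  have hMT : A⁻¹.transpose = A⁻¹ := by rw [Matrix.transpose_nonsing_inv, hAT]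
  set M := A⁻¹ with hM
  set N := M * C with hN
  set K := B - C.transpose * M * C with hK
  have hKT : K.transpose = K := by
    rw [hK, Matrix.transpose_sub, hB, Matrix.transpose_mul, Matrix.transpose_mul, hMT,
      Matrix.transpose_transpose, Matrix.mul_assoc]
  let E := overlapExponent A B C a b
  have hEc : ∀ y, Continuous fun t : Config ι => E y t.ofLp := continuous_overlapExponent
  have hprod : ∀ y y' : ι → ℝ, ∀ t : Config ι,
      c * Complex.exp (E y t.ofLp) * (c * Complex.exp (E y' (t.ofLp + y))) =
        c * Complex.exp (E 0 (t.ofLp + y)) * (c * Complex.exp (E (y + y') t.ofLp)) := by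
    intro y y'
    have hsh : Continuous fun t : Config ι => t + WithLp.toLp 2 y := by fun_prop
    have hq := (measurePreserving_add_right (volume : Measure (Config ι))
      (WithLp.toLp 2 y)).quasiMeasurePreserving
    have hae : (fun t : Config ι =>
        c * Complex.exp (E y t.ofLp) * (c * Complex.exp (E y' (t.ofLp + y)))) =ᵐ[volume]
        fun t => c * Complex.exp (E 0 (t.ofLp + y)) * (c * Complex.exp (E (y + y') t.ofLp)) := by
      filter_upwards [hov y, hov (y + y'), hq.ae (hov y'), hq.ae (hov 0)] with t h1 h2 h3 h4
      change _ = c * Complex.exp (E y' (t.ofLp + y)) at h3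
      change _ = c * Complex.exp (E 0 (t.ofLp + y)) at h4
      change _ = c * Complex.exp (E y t.ofLp) at h1
      change _ = c * Complex.exp (E (y + y') t.ofLp) at h2
      rw [← h1, ← h2, ← h3, ← h4, WithLp.toLp_zero, add_zero, WithLp.toLp_add, add_assoc]
      ring
    have hc1' : Continuous fun t : Config ι => E y' (t.ofLp + y) := (hEc y').comp hsh
    have hc0' : Continuous fun t : Config ι => E 0 (t.ofLp + y) := (hEc 0).comp hsh
    -- Both sides are continuous, so equality almost everywhere is equality everywhere and a
    -- particular `t` may be inserted.
    exact congrFun ((Continuous.ae_eq_iff_eq volume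
      ((continuous_const.mul (hEc y).cexp).mul (continuous_const.mul hc1'.cexp))
      ((continuous_const.mul hc0'.cexp).mul (continuous_const.mul (hEc (y + y')).cexp))).mp hae)
  have hexp : ∀ y y' : ι → ℝ, Complex.exp
      (((1 / 2 * (y ⬝ᵥ K.mulVec y' - y ⬝ᵥ M.mulVec y') : ℝ) : ℂ) +
        Complex.I * ((1 / 2 * (N.mulVec y' ⬝ᵥ y - N.mulVec y ⬝ᵥ y') : ℝ) : ℂ)) = 1 := by
    intro y y'
    -- At t = a - y the exponent of the factor with increment 0 vanishes, and only terms bilinear in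
    -- (y, y') survive.
    have h1 := hprod y y' (WithLp.toLp 2 (a - y))
    have h2 : E y (a - y) + E y' (a - y + y) = (E 0 (a - y + y) + E (y + y') (a - y)) +
        (((1 / 2 * (y ⬝ᵥ K.mulVec y' - y ⬝ᵥ M.mulVec y') : ℝ) : ℂ) +
        Complex.I * ((1 / 2 * (N.mulVec y' ⬝ᵥ y - N.mulVec y ⬝ᵥ y') : ℝ) : ℂ)) := by
      have e1 : a - y + (1 / 2 : ℝ) • y - a = (-(1 / 2 : ℝ)) • y := by module
      have e2 : a - y + y + (1 / 2 : ℝ) • y' - a = (1 / 2 : ℝ) • y' := by module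
      have e3 : a - y + y + (1 / 2 : ℝ) • (0 : ι → ℝ) - a = 0 := by module
      have e4 : a - y + (1 / 2 : ℝ) • (y + y') - a =
        (1 / 2 : ℝ) • y' + (-(1 / 2 : ℝ)) • y := by module
      have s1 : y' ⬝ᵥ K.mulVec y = y ⬝ᵥ K.mulVec y' := by
        rw [Matrix.dotProduct_mulVec, ← Matrix.mulVec_transpose, hKT, dotProduct_comm]
      have s2 : y' ⬝ᵥ M.mulVec y = y ⬝ᵥ M.mulVec y' := by
        rw [Matrix.dotProduct_mulVec, ← Matrix.mulVec_transpose, hMT, dotProduct_comm]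
      simp only [E, overlapExponent, ← hM, ← hN, ← hK, e1, e2, e3, e4]
      simp only [Matrix.mulVec_add, Matrix.mulVec_smul, dotProduct_add, add_dotProduct,
        dotProduct_smul, smul_dotProduct, Matrix.mulVec_zero, dotProduct_zero,
        smul_eq_mul, s1, s2]
      push_cast
      ring
    have h3 : Complex.exp (E y (a - y) + E y' (a - y + y)) =
        Complex.exp (E 0 (a - y + y) + E (y + y') (a - y)) := by
      rw [Complex.exp_add, Complex.exp_add]
      refine mul_left_cancel₀ (mul_ne_zero hc hc) ?_
      linear_combination h1
    rw [h2, Complex.exp_add] at h3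
    exact mul_left_cancel₀ (Complex.exp_ne_zero _) (h3.trans (mul_one _).symm)
  have hzero : ∀ y y' : ι → ℝ, (((1 / 2 * (y ⬝ᵥ K.mulVec y' - y ⬝ᵥ M.mulVec y') : ℝ) : ℂ) +
        Complex.I * ((1 / 2 * (N.mulVec y' ⬝ᵥ y - N.mulVec y ⬝ᵥ y') : ℝ) : ℂ)) = 0 := by
    intro y y'
    -- The exponent is linear in y, so replacing y by s·y multiplies it by s.
    refine eq_zero_of_forall_exp_smul_eq_one fun s => ?_
    rw [← hexp (s • y) y']
    simp only [Matrix.mulVec_smul, dotProduct_smul, smul_dotProduct, smul_eq_mul]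
    congr 1
    push_cast
    ring
  constructor
  · refine Matrix.eq_of_forall_dotProduct_mulVec fun y y' => ?_
    have h1 := congrArg Complex.re (hzero y y')
    rw [Complex.add_re, Complex.ofReal_re, Complex.I_mul_re, Complex.ofReal_im,
      Complex.zero_re] at h1
    linarith
  · refine Matrix.eq_of_forall_dotProduct_mulVec fun y y' => ?_
    have h1 := congrArg Complex.im (hzero y y')
    rw [Complex.add_im, Complex.ofReal_im, Complex.I_mul_im, Complex.ofReal_re,
      Complex.zero_im] at h1
    rw [Matrix.mulVec_transpose, dotProduct_comm, ← Matrix.dotProduct_mulVec,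
      dotProduct_comm y' , dotProduct_comm y]
    linarith

end Gaussian

/-! ### The covariance matrix of a pure Gaussian state. -/

section Pure

variable {ι : Type} [Fintype ι]

theorem cov_transpose [DecidableEq ι] (ρ : State ι) : ρ.cov.transpose = ρ.cov := by
  ext k l
  simp only [Matrix.transpose_apply, State.cov, Matrix.of_apply]
  rw [add_comm]

/-- The quadratic form of a symmetric matrix in terms of its position and momentum blocks. -/
theorem phasePoint_dotProduct_mulVec {Γ : Matrix (Phase ι) (Phase ι) ℝ} (hΓ : Γ.transpose = Γ)
    (x y : ι → ℝ) :
    phasePoint x y ⬝ᵥ Γ.mulVec (phasePoint x y) =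
      x ⬝ᵥ (Matrix.of fun i j => Γ (i, 0) (j, 0)).mulVec x +
        2 * (x ⬝ᵥ (Matrix.of fun i j => Γ (i, 0) (j, 1)).mulVec y) +
        y ⬝ᵥ (Matrix.of fun i j => Γ (i, 1) (j, 1)).mulVec y := by
  have hs : ∀ p q, Γ p q = Γ q p := fun p q => congrFun (congrFun hΓ q) p
  simp only [dotProduct, Matrix.mulVec, Fintype.sum_prod_type, Fin.sum_univ_two, phasePoint,
    Matrix.of_apply, if_true, one_ne_zero, if_false, Finset.mul_sum, Finset.sum_add_distrib,
    mul_add]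
  have h1 : ∑ i, ∑ j, y i * (Γ (i, 1) (j, 0) * x j) = ∑ i, ∑ j, x i * (Γ (i, 0) (j, 1) * y j) := by
    rw [Finset.sum_comm]
    refine Finset.sum_congr rfl fun i _ => Finset.sum_congr rfl fun j _ => ?_
    rw [hs]
    ring
  rw [h1]
  simp only [two_mul, Finset.sum_add_distrib]
  ring

variable [DecidableEq ι]

/-- The covariance matrix of a pure Gaussian state is positive definite and symplectic. -/
theorem posDef_and_symplectic_of_charFn {Γ : Matrix (Phase ι) (Phase ι) ℝ}
    (hΓ : Γ.transpose = Γ) {d : Phase ι → ℝ} {ψ : Space ι} (hψ : ‖ψ‖ = 1)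
    (h : ∀ z, ⟪ψ, weyl z ψ⟫_ℂ = Complex.exp (-(1 / 4 : ℂ) * ((z ⬝ᵥ Γ.mulVec z : ℝ) : ℂ) +
      Complex.I * ((d ⬝ᵥ z : ℝ) : ℂ))) : Γ.PosDef ∧ IsSymplectic Γ := by
  have hpsd := posSemidef_of_charFn hΓ hψ h
  have hs : ∀ p q, Γ p q = Γ q p := fun p q => congrFun (congrFun hΓ q) p
  set A : Matrix ι ι ℝ := Matrix.of fun i j => Γ (i, 0) (j, 0) with hAdef
  set C : Matrix ι ι ℝ := Matrix.of fun i j => Γ (i, 0) (j, 1) with hCdef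
  set B : Matrix ι ι ℝ := Matrix.of fun i j => Γ (i, 1) (j, 1) with hBdef
  have hquad := phasePoint_dotProduct_mulVec hΓ
  rw [← hAdef, ← hCdef, ← hBdef] at hquad
  have hBT : B.transpose = B := by
    ext i j
    exact hs _ _
  have hchar : ∀ x y : ι → ℝ, ⟪ψ, weyl (phasePoint x y) ψ⟫_ℂ = Complex.exp (-(1 / 4 : ℂ) *
      ((x ⬝ᵥ A.mulVec x + 2 * (x ⬝ᵥ C.mulVec y) + y ⬝ᵥ B.mulVec y : ℝ) : ℂ) +
      Complex.I * (((fun i => d (i, 0)) ⬝ᵥ x + (fun i => d (i, 1)) ⬝ᵥ y : ℝ) : ℂ)) := by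
    intro x y
    rw [h, hquad]
    congr 4
    simp [dotProduct, Fintype.sum_prod_type, phasePoint, Finset.sum_add_distrib]
  have hA : A.PosDef := by
    refine Matrix.PosDef.of_dotProduct_mulVec_pos ?_ fun x hx => ?_
    · rw [Matrix.IsHermitian, Matrix.conjTranspose_eq_transpose_of_trivial]
      ext i j
      exact hs _ _
    · rw [star_trivial]
      have h1 : 0 ≤ x ⬝ᵥ A.mulVec x := by
        have h2 := hpsd.dotProduct_mulVec_nonneg (phasePoint x 0)
        rw [star_trivial, hquad] at h2
        simpa using h2
      -- If the form vanished at x, the characteristic function would be a pure phase along the line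
      -- through x.
      refine lt_of_le_of_ne h1 fun h0 => ?_
      obtain ⟨s, hs1⟩ := exists_norm_inner_weyl_ne_one ψ hx
      refine hs1 ?_
      rw [hchar]
      simp only [Matrix.mulVec_smul, dotProduct_smul, smul_dotProduct, ← h0, Matrix.mulVec_zero,
        dotProduct_zero, smul_zero, mul_zero, add_zero, Complex.ofReal_zero, zero_add]
      rw [mul_comm Complex.I, Complex.norm_exp_ofReal_mul_I]
  obtain ⟨hK, hN⟩ := relations_of_charFn hA hchar hBT
  have hAu := (Matrix.isUnit_iff_isUnit_det A).mp hA.isUnit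
  have hAi : A * A⁻¹ = 1 := Matrix.mul_nonsing_inv A hAu
  have hAi' : A⁻¹ * A = 1 := Matrix.nonsing_inv_mul A hAu
  have hAT : A.transpose = A := by
    ext i j
    exact hs _ _
  rw [Matrix.transpose_mul, Matrix.transpose_nonsing_inv, hAT] at hN
  have hB : B = A⁻¹ + A⁻¹ * C * C := by
    rw [sub_eq_iff_eq_add] at hK
    rw [hK, hN]
  -- Sorted into positions and momenta, ΓΔΓᵀ = Δ consists of `h00`, `h01`, the transpose of `h01`,
  -- and `h11`.
  have h00 : A * C.transpose = C * A := by
    have h1 : A * (C.transpose * A⁻¹) * A = A * (A⁻¹ * C) * A := by rw [hN]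
    rwa [← Matrix.mul_assoc A A⁻¹ C, hAi, Matrix.one_mul, Matrix.mul_assoc A, Matrix.mul_assoc _ _ A,
      hAi', Matrix.mul_one] at h1
  have h01 : A * B = 1 + C * C := by
    rw [hB, Matrix.mul_add, hAi, ← Matrix.mul_assoc, ← Matrix.mul_assoc, hAi, Matrix.one_mul]
  have h11 : C.transpose * B = B * C := by
    rw [hB, Matrix.mul_add, Matrix.add_mul, hN, ← Matrix.mul_assoc, ← Matrix.mul_assoc, hN]
  have hsymp : IsSymplectic Γ := by
    rw [IsSymplectic]
    ext ⟨i, α⟩ ⟨j, β⟩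
    rw [mul_mul_transpose_apply, dotProduct_sympForm_mulVec, Finset.sum_sub_distrib, sympForm_apply]
    have e10 : ∀ i k, Γ (i, 1) (k, 0) = C k i := fun i k => hs _ _
    have g00 := congrFun (congrFun h00 i) j
    have g01 := congrFun (congrFun h01 i) j
    have g10 := congrFun (congrFun h01 j) i
    have g11 := congrFun (congrFun h11 i) j
    simp only [Matrix.mul_apply, Matrix.add_apply, Matrix.transpose_apply, Matrix.one_apply]
      at g00 g01 g10 g11
    have hA' : ∀ i j, A i j = A j i := fun i j => hs _ _
    have hB' : ∀ i j, B i j = B j i := fun i j => hs _ _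
    simp only [hB' _ j] at g01 g11
    simp only [hB' _ i] at g10
    simp only [hA' _ j] at g00
    fin_cases α <;> fin_cases β
    · change ∑ k, A i k * C j k - ∑ k, C i k * A j k = _
      simp [g00]
    · change ∑ k, A i k * B j k - ∑ k, C i k * Γ (j, 1) (k, 0) = _
      simp only [e10, g01]
      simp
    · change ∑ k, Γ (i, 1) (k, 0) * C j k - ∑ k, B i k * A j k = _
      simp only [e10]
      simp_rw [mul_comm (B i _), g10, mul_comm (C _ i)]
      by_cases hij : i = j
      · simp [hij]
      · simp [hij, Ne.symm hij]
    · change ∑ k, Γ (i, 1) (k, 0) * B j k - ∑ k, B i k * Γ (j, 1) (k, 0) = _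
      simp only [e10, g11]
      simp
  -- Semidefiniteness improves to definiteness because a symplectic matrix is invertible.
  refine ⟨hpsd.posDef_iff_det_ne_zero.mpr fun h0 => ?_, hsymp⟩
  have := hsymp.det_sq
  rw [h0] at this
  norm_num at this

theorem State.IsGaussian.cov_posDef_and_symplectic {ρ : State ι} (hg : ρ.IsGaussian)
    (hp : ρ.IsPure) : ρ.cov.PosDef ∧ IsSymplectic ρ.cov := by
  obtain ⟨ψ, hψ, hop⟩ := hp
  exact posDef_and_symplectic_of_charFn (cov_transpose ρ) hψ fun z =>
    (charFn_eq_inner hop z).symm.trans (hg.2 z)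

end Pure

/-! ### Determinants and the correlation measure. -/

variable {n m : ℕ}

theorem sympForm_submatrix :
    (sympForm (Fin n ⊕ Fin m)).submatrix (Equiv.sumProdDistrib (Fin n) (Fin m) (Fin 2)).symm
      (Equiv.sumProdDistrib (Fin n) (Fin m) (Fin 2)).symm = biForm n m := by
  ext (⟨i, a⟩ | ⟨i, a⟩) (⟨j, b⟩ | ⟨j, b⟩) <;>
    simp [biForm, sympForm_apply]

theorem blockCov_mul_biForm_mul {ρ : BiState n m} (h : IsSymplectic ρ.cov) :
    blockCov ρ * biForm n m * blockCov ρ = biForm n m := by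
  rw [IsSymplectic, cov_transpose] at h
  rw [← sympForm_submatrix, blockCov, Matrix.submatrix_mul_equiv, Matrix.submatrix_mul_equiv, h]

theorem det_blockCov {ρ : BiState n m} (hpd : ρ.cov.PosDef) (h : IsSymplectic ρ.cov) :
    (blockCov ρ).det = 1 := by
  rw [blockCov, Matrix.det_submatrix_equiv_self]
  have h1 := h.det_sq
  have h2 := hpd.det_pos
  nlinarith

theorem det_diagonal_padded (γ : Fin n → ℝ) (hnm : n ≤ m) :
    (Matrix.diagonal fun q : Phase (Fin m) => if h : (q.1 : ℕ) < n then γ ⟨q.1, h⟩ else 1).det =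
      ∏ j, γ j ^ 2 := by
  obtain ⟨r, rfl⟩ := Nat.exists_eq_add_of_le hnm
  rw [Matrix.det_diagonal, Fintype.prod_prod_type]
  rw [Fin.prod_univ_add]
  simp

/-- The correlation measure of a pure Gaussian state in terms of its mixedness factors. -/
theorem corr_eq_of_isMixednessFactors (hnm : n ≤ m) {ρ : BiState n m} (hdet : (blockCov ρ).det = 1)
    {γ : Fin n → ℝ} (hγ : IsMixednessFactors ρ γ) : corr ρ = 1 - 1 / ∏ j, γ j ^ 4 := by
  obtain ⟨-, SA, SB, hSA, hSB, hS⟩ := hγ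
  rw [← Matrix.fromBlocks_toBlocks (blockCov ρ)] at hS
  simp only [normalForm, Matrix.fromBlocks_transpose, Matrix.fromBlocks_multiply,
    Matrix.transpose_zero, Matrix.mul_zero, Matrix.zero_mul, add_zero, zero_add] at hS
  -- A local transformation acts on A and B separately, so the diagonal blocks suffice: each
  -- contributes ∏ γ_j², two quadratures per mode.
  obtain ⟨hA, -, -, hB⟩ := Matrix.fromBlocks_inj.mp hS
  have hA' := congrArg Matrix.det hA
  have hB' := congrArg Matrix.det hB
  rw [Matrix.det_mul, Matrix.det_mul, Matrix.det_transpose, mul_right_comm, ← sq, hSA.det_sq,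
    one_mul, Matrix.det_diagonal, Fintype.prod_prod_type] at hA'
  rw [Matrix.det_mul, Matrix.det_mul, Matrix.det_transpose, mul_right_comm, ← sq, hSB.det_sq,
    one_mul, det_diagonal_padded γ hnm] at hB'
  simp only [Finset.prod_const, Finset.card_univ, Fintype.card_fin] at hA'
  rw [corr, hdet, hA', hB', ← Finset.prod_mul_distrib]
  simp only [← pow_add]

theorem exists_isMixednessFactors (hnm : n ≤ m) {ρ : BiState n m} (hp : ρ.IsPure)
    (hg : ρ.IsGaussian) : ∃ γ : Fin n → ℝ, IsMixednessFactors ρ γ := by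
  obtain ⟨hpd, hs⟩ := hg.cov_posDef_and_symplectic hp
  exact exists_modewise_normalForm hnm (hpd.submatrix (Equiv.injective _))
    (blockCov_mul_biForm_mul hs)

theorem corr_eq (hnm : n ≤ m) {ρ : BiState n m} (hp : ρ.IsPure) (hg : ρ.IsGaussian)
    {γ : Fin n → ℝ} (hγ : IsMixednessFactors ρ γ) : corr ρ = 1 - 1 / ∏ j, γ j ^ 4 := by
  obtain ⟨hpd, hs⟩ := hg.cov_posDef_and_symplectic hp
  exact corr_eq_of_isMixednessFactors hnm (det_blockCov hpd hs) hγ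

end CV

theorem theorem5 :
    (∀ n m : ℕ, 1 ≤ n → n ≤ m → ∀ ρ : CV.BiState n m, ρ.IsPure → ρ.IsGaussian →
      (∃ γ : Fin n → ℝ, CV.IsMixednessFactors ρ γ) ∧
      ∀ γ : Fin n → ℝ, CV.IsMixednessFactors ρ γ →
        CV.corr ρ = 1 - 1 / ∏ j, γ j ^ 4) ∧
    (∀ m : ℕ, 1 ≤ m → ∀ ρ : CV.BiState 1 m, ρ.IsPure → ρ.IsGaussian →
      (∃ γ : ℝ, CV.IsMixednessFactors ρ (fun _ => γ)) ∧
      ∀ γ : ℝ, CV.IsMixednessFactors ρ (fun _ => γ) →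
        CV.corr ρ = 1 - 1 / γ ^ 4) := by
  refine ⟨fun n m _ hnm ρ hp hg => ⟨CV.exists_isMixednessFactors hnm hp hg,
    fun γ hγ => CV.corr_eq hnm hp hg hγ⟩, fun m hm ρ hp hg => ⟨?_, fun γ hγ => ?_⟩⟩
  · obtain ⟨γ, hγ⟩ := CV.exists_isMixednessFactors hm hp hg
    refine ⟨γ 0, ?_⟩
    have h1 : (fun _ => γ 0) = γ := funext fun j => by rw [Subsingleton.elim j 0]
    rwa [h1]
  · simpa using CV.corr_eq hm hp hg hγ
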